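/- Let $k,d$ be fixed natural numbers. An $n$-qubit operator $H$ is called a $k$-local Hamiltonian of degree at most $d$ if $H=\sum_a h_a$ is a finite sum of Hermitian terms, each acting non-trivially on at most $k$ qubits, such that each qubit is acted on by at most $d$ of the terms. Then there is a polynomial-time quantum algorithm $\mathcal{A}$ with (forward) query access to an $n$-qubit unitary $U$, depending only on $k$ and $d$ (in particular not on $H$), and an $n_0\in\mathbb{N}$, such that for all $n\ge n_0$, every $k$-local $n$-qubit Hamiltonian $H$ of degree at most $d$ that is not a scalar multiple of the identity, and every probability distribution $\mathcal{U}$ on $\mathbb{U}(2^n)$ with $[U,H]=0$ for ($\mathcal U$-almost) all $U$, $$\Pr_{U\sim\mathcal{U}}\big[\mathcal{A}^U(1^n)=1\big]\ \ge\ \tfrac23,\qquad \Pr_{U\sim\mathrm{Haar}(\mathbb{U}(2^n))}\big[\mathcal{A}^U(1^n)=1\big]\ \le\ \tfrac13 .$$ Here $U$ is drawn once and all queries of a run are answered by the same $U$. A polynomial-time quantum algorithm is a single program, for all $n$, of a random access machine (constants, addition, truncated subtraction, indirect addressing, branching, loops, each at unit cost) that controls $n+\mathrm{poly}(n)$ qubits,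 initially in $|0\cdots0\rangle$, by Hadamard, $S$, $T$, $X$ and CNOT gates, computational-basis measurements and applications of $U$ to the $n$ system qubits, and that halts within $\mathrm{poly}(n)$ steps for every $U$ and all measurement outcomes. -/

import Mathlib

open MeasureTheory

noncomputable section

namespace EnergyConservation

/-! ### Qubits, unitary ensembles and the Haar ensemble -/

/-- Labels of the computational basis of `n` qubits. -/
abbrev Bits (n : ℕ) : Type := Fin n → Bool

/-- Linear operators on the `2 ^ n`-dimensional Hilbert space of `n` qubits. -/
abbrev Operator (n : ℕ) : Type := Matrix (Bits n) (Bits n) ℂ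

/-- The group of `n`-qubit unitaries. -/
abbrev UnitaryOp (n : ℕ) : Type := Matrix.unitaryGroup (Bits n) ℂ

instance (n : ℕ) : MeasurableSpace (UnitaryOp n) := borel _

instance (n : ℕ) : BorelSpace (UnitaryOp n) := ⟨rfl⟩

instance (n : ℕ) : CompactSpace (UnitaryOp n) := by
  apply isCompact_iff_compactSpace.mp
  have hbox : IsCompact (Set.univ.pi fun _ : Bits n =>
      (Set.univ.pi fun _ : Bits n => Metric.closedBall (0 : ℂ) 1)) :=
    isCompact_univ_pi fun _ => isCompact_univ_pi fun _ => isCompact_closedBall _ _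
  have hclosed : IsClosed (Matrix.unitaryGroup (Bits n) ℂ : Set (Operator n)) := by
    have hset : (Matrix.unitaryGroup (Bits n) ℂ : Set (Operator n))
        = {A : Operator n | A * star A = 1} := by
      ext A
      exact Matrix.mem_unitaryGroup_iff
    rw [hset]
    exact isClosed_eq (by fun_prop) continuous_const
  have hsub : (Matrix.unitaryGroup (Bits n) ℂ : Set (Operator n)) ⊆ Set.univ.pi fun _ : Bits n =>
      (Set.univ.pi fun _ : Bits n => Metric.closedBall (0 : ℂ) 1) := by
    intro A hA i _ j _
    simpa using entry_norm_bound_of_unitary hA i j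
  exact IsCompact.of_isClosed_subset (X := Operator n) hbox hclosed hsub

/-- The Haar ensemble on the full `n`-qubit unitary group: its Haar measure of total mass one. -/
def haarEnsemble (n : ℕ) : Measure (UnitaryOp n) :=
  Measure.haarMeasure ⊤

instance (n : ℕ) : IsProbabilityMeasure (haarEnsemble n) :=
  ⟨by simpa [haarEnsemble] using
    Measure.haarMeasure_self (K₀ := (⊤ : TopologicalSpace.PositiveCompacts (UnitaryOp n)))⟩

/-! ### Local Hamiltonians of bounded degree -/

/-- `A` acts nontrivially only on the qubits in `S`: it is `B ⊗ 1` for an operator `B` on the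
qubits in `S` and the identity on the other qubits. -/
def ActsOn {n : ℕ} (S : Finset (Fin n)) (A : Operator n) : Prop :=
  ∃ B : Matrix (S → Bool) (S → Bool) ℂ, ∀ x y : Bits n,
    A x y = if ∀ i, i ∉ S → x i = y i then B (fun i => x i) (fun i => y i) else 0

/-- `H` is a sum of Hermitian terms, each acting on at most `k` qubits, such that each qubit is
acted on by at most `d` terms. -/
def IsLocalHamiltonian {n : ℕ} (k d : ℕ) (H : Operator n) : Prop :=
  ∃ (m : ℕ) (S : Fin m → Finset (Fin n)) (h : Fin m → Operator n),
    (∀ a, (h a).IsHermitian ∧ (S a).card ≤ k ∧ ActsOn (S a) (h a)) ∧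
    (∀ i : Fin n, (Finset.univ.filter fun a => i ∈ S a).card ≤ d) ∧
    H = ∑ a, h a

/-! ### Quantum algorithms with oracle access to a unitary

The machine model is a random access machine on natural numbers (constants, addition, truncated
subtraction, indirect addressing, branching, loops) that controls a register of qubits, on which
it can apply gates from a universal gate set, query the oracle and measure in the computational
basis. Every elementary instruction, every test and every loop iteration costs one time step. -/

/-- The elementary single-qubit gates. -/
inductive Gate : Type
  | X
  | S
  | H
  | T

/-- The matrix of a single-qubit gate in the computational basis. -/
def Gate.mat : Gate → Matrix Bool Bool ℂ
  | .X => Matrix.of fun b c => if b = c then 0 else 1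
  | .S => Matrix.of fun b c => if b = c then (if b then Complex.I else 1) else 0
  | .H => Matrix.of fun b c => (if b && c then -1 else 1) / (Real.sqrt 2 : ℂ)
  | .T => Matrix.of fun b c =>
      if b = c then (if b then Complex.exp (Real.pi / 4 * Complex.I) else 1) else 0

/-- Programs. All operands are indices of classical registers; a qubit is addressed by the
content of a classical register. -/
inductive Program : Type
  /-- `r := c` -/
  | const (r c : ℕ)
  /-- `r := s + t` -/
  | add (r s t : ℕ)
  /-- `r := s - t`, truncated at zero -/
  | sub (r s t : ℕ)
  /-- `r :=` the content of the register whose index is the content of `s` -/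
  | load (r s : ℕ)
  /-- the register whose index is the content of `r` is set to the content of `s` -/
  | store (r s : ℕ)
  /-- apply the gate `g` to the qubit addressed by `q` -/
  | gate (g : Gate) (q : ℕ)
  /-- apply a controlled-NOT gate to the qubits addressed by `q` (control) and `q'` (target) -/
  | cnot (q q' : ℕ)
  /-- apply the oracle unitary to the `n` system qubits -/
  | query
  /-- measure the qubit addressed by `q` and write the outcome into `r` -/
  | measure (q r : ℕ)
  /-- sequential composition -/
  | seq (P Q : Program)
  /-- if the content of `r` is zero do `P`, otherwise do `Q` -/
  | ifZero (r : ℕ) (P Q : Program)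
  /-- repeat `P` as many times as the content of `r` says when the loop is entered -/
  | loop (r : ℕ) (P : Program)

/-- The qubits of the machine: `n` system qubits and `a` ancillas. -/
abbrev Wire (n a : ℕ) : Type := Fin n ⊕ Fin a

/-- Vectors in the state space of the `n + a` qubits, by their amplitudes in the computational
basis. -/
abbrev StateVec (n a : ℕ) : Type := (Wire n a → Bool) → ℂ

/-- The qubit with address `q`: the system qubits come first, then the ancillas. -/
def wireAt (n a q : ℕ) : Option (Wire n a) :=
  if hq : q < n + a then some (finSumFinEquiv.symm ⟨q, hq⟩) else none

/-- Apply a single-qubit operator to the qubit `w`. -/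
def applyGate {n a : ℕ} (M : Matrix Bool Bool ℂ) (w : Wire n a) (ψ : StateVec n a) :
    StateVec n a :=
  fun b => ∑ c : Bool, M (b w) c * ψ (Function.update b w c)

/-- Apply a controlled-NOT gate (nothing happens if control and target coincide). -/
def applyCNOT {n a : ℕ} (w w' : Wire n a) (ψ : StateVec n a) : StateVec n a :=
  fun b => if w = w' then ψ b else ψ (Function.update b w' (xor (b w') (b w)))

/-- Apply `U ⊗ 1`, with `U` on the `n` system qubits and the identity on the ancillas. -/
def applyOracle {n a : ℕ} (U : Operator n) (ψ : StateVec n a) : StateVec n a :=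
  fun b => ∑ x : Bits n, U (fun i => b (Sum.inl i)) x *
    ψ (Sum.elim x (fun j => b (Sum.inr j)))

/-- Project onto the outcome `o` of a computational-basis measurement of the qubit `w`. -/
def project {n a : ℕ} (w : Wire n a) (o : Bool) (ψ : StateVec n a) : StateVec n a :=
  fun b => if b w = o then ψ b else 0

/-- A branch of a computation: register contents, elapsed time, and the unnormalized state vector
of the qubits, whose squared norm is the probability of the branch. -/
structure Branch (n a : ℕ) : Type where
  reg : ℕ → ℕ
  time : ℕ
  vec : StateVec n a

namespace Branch

variable {n a : ℕ}

/-- The squared norm of the state vector. -/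
def weight (s : Branch n a) : ℝ := ∑ b, ‖s.vec b‖ ^ 2

/-- Let one time step pass. -/
def tick (s : Branch n a) : Branch n a := { s with time := s.time + 1 }

/-- Write the value `v` into the register `r`. -/
def write (s : Branch n a) (r v : ℕ) : Branch n a := { s with reg := Function.update s.reg r v }

/-- Transform the state vector. -/
def mapVec (s : Branch n a) (f : StateVec n a → StateVec n a) : Branch n a :=
  { s with vec := f s.vec }

end Branch

/-- Execute a program from a branch, with oracle unitary `U`; the result lists the branches that
arise from the measurement outcomes. Operations on qubits that do not exist do nothing, and a
measurement of such a qubit returns `0`. -/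
def Program.exec {n a : ℕ} (U : Operator n) : Program → Branch n a → List (Branch n a)
  | .const r c, s => [s.tick.write r c]
  | .add r p q, s => [s.tick.write r (s.reg p + s.reg q)]
  | .sub r p q, s => [s.tick.write r (s.reg p - s.reg q)]
  | .load r p, s => [s.tick.write r (s.reg (s.reg p))]
  | .store r p, s => [s.tick.write (s.reg r) (s.reg p)]
  | .gate g q, s =>
      match wireAt n a (s.reg q) with
      | some w => [s.tick.mapVec (applyGate g.mat w)]
      | none => [s.tick]
  | .cnot q q', s =>
      match wireAt n a (s.reg q), wireAt n a (s.reg q') with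
      | some w, some w' => [s.tick.mapVec (applyCNOT w w')]
      | _, _ => [s.tick]
  | .query, s => [s.tick.mapVec (applyOracle U)]
  | .measure q r, s =>
      match wireAt n a (s.reg q) with
      | some w => [(s.tick.write r 0).mapVec (project w false),
          (s.tick.write r 1).mapVec (project w true)]
      | none => [s.tick.write r 0]
  | .seq P Q, s => (P.exec U s).flatMap (Q.exec U)
  | .ifZero r P Q, s => if s.reg r = 0 then P.exec U s.tick else Q.exec U s.tick
  | .loop r P, s =>
      (fun L : List (Branch n a) => L.flatMap fun t => P.exec U t.tick)^[s.reg r] [s.tick]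

/-- A quantum algorithm with oracle access to an `n`-qubit unitary: one program for all `n`, and
the number of ancilla qubits, which is a polynomial in `n`. -/
structure OracleAlgorithm : Type where
  program : Program
  ancillas : Polynomial ℕ

namespace OracleAlgorithm

/-- The initial branch: register `0` contains `n`, all other registers contain `0`, and all qubits
are in the state `|0⟩`. -/
def init (A : OracleAlgorithm) (n : ℕ) : Branch n (A.ancillas.eval n) where
  reg := Function.update (fun _ => 0) 0 n
  time := 0
  vec := Pi.single (fun _ => false) 1

/-- All branches at the end of the run of the algorithm on input `n` with oracle unitary `U`. -/
def run (A : OracleAlgorithm) (n : ℕ) (U : UnitaryOp n) : List (Branch n (A.ancillas.eval n)) :=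
  A.program.exec (U : Operator n) (A.init n)

/-- The probability that the algorithm, with oracle unitary `U`, outputs `1`, the output being the
final content of register `1`. -/
def acceptProb (A : OracleAlgorithm) (n : ℕ) (U : UnitaryOp n) : ℝ :=
  (((A.run n U).filter fun s => s.reg 1 = 1).map Branch.weight).sum

/-- The algorithm runs in polynomial time: on every oracle and for all measurement outcomes. -/
def PolyTime (A : OracleAlgorithm) : Prop :=
  ∃ p : Polynomial ℕ, ∀ (n : ℕ) (U : UnitaryOp n), ∀ s ∈ A.run n U, s.time ≤ p.eval n

end OracleAlgorithm

end EnergyConservation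

end

open EnergyConservation

/-! If U commutes with H, then U H U† = H. Let c_l = tr(P_l H) be the Pauli coefficients of H and
M_lm = 2⁻ⁿ tr(P_l U P_m U†) the correlators (`corr`); invariance says c = M c. Locality confines c
to strings on at most k qubits, the identity string decouples from the others, and c is nonzero away
from it because H is not scalar. So the block of M on local non-identity strings fixes a nonzero
vector, and its squared Frobenius norm S is at least 1 (`one_le_sum_corr_sq`).

For Haar random U, each M_lm² with P_l ≠ 1 has mean at most 2/4ⁿ (`integral_corr_sq_le`): left
invariance gives the same mean to all 4ⁿ/2 strings that anticommute with P_l, while the M_lm² sum to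
1 over l. As there are polynomially many local pairs, S is exponentially small on average.

S can be tested without knowing H. Prepare a random eigenstate of P_m, apply U and measure P_l: the
product of the two eigenvalues has mean M_lm, and the product over two independent runs has mean
M_lm² (`transforms_compareRuns`). With K = k + 1, the program lists L = (3n)^(2K) pairs, repetitions
allowed, collects one such sign for each, repeats this N = n^(2K+1) times and accepts if the signs
sum to at least N/2. With S now summed over the list, the total has mean N S and variance at most N
L. Second moments bound the rejection probability by 4L/N if S ≥ 1, and the acceptance probability
by 4S² + 4L/N always; S² ≤ L S then makes the Haar average at most 8L²/4ⁿ + 4L/N.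

The machine is analysed backwards: `Program.sem` sends an observable of the final branches to one of
the initial branch (`Program.sum_exec`). Program pieces act on functions of the tally alone
(`Transforms`), so the acceptance probability is an iterate of explicit averaging operators, through
which quadratic bounds propagate (`iterate_repetition_le`). All loops make n passes, whence
polynomial time. -/

namespace EnergyConservation

open Function (update)

/-! ### Running time -/

/-- Every loop of the program runs over register `0`, and the program never writes to it. -/
def Program.LoopsOverInput : Program → Prop
  | .const r _ => r ≠ 0
  | .add r _ _ => r ≠ 0
  | .sub r _ _ => r ≠ 0
  | .load r _ => r ≠ 0
  | .store _ _ => False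
  | .gate _ _ => True
  | .cnot _ _ => True
  | .query => True
  | .measure _ r => r ≠ 0
  | .seq P Q => P.LoopsOverInput ∧ Q.LoopsOverInput
  | .ifZero _ P Q => P.LoopsOverInput ∧ Q.LoopsOverInput
  | .loop r P => r = 0 ∧ P.LoopsOverInput

/-- A bound on the running time of a program all of whose loops run over register `0`. -/
noncomputable def Program.cost : Program → Polynomial ℕ
  | .seq P Q => P.cost + Q.cost
  | .ifZero _ P Q => 1 + P.cost + Q.cost
  | .loop _ P => 1 + Polynomial.X * (1 + P.cost)
  | _ => 1

/-- Register `0` keeps the value n, so every loop makes exactly n passes. That invariant is part of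
the conclusion because sequential composition and later passes need it again. -/
theorem Program.time_le_cost {n a : ℕ} (U : Operator n) (P : Program) (hP : P.LoopsOverInput)
    (s : Branch n a) (hs : s.reg 0 = n) :
    ∀ t ∈ P.exec U s, t.reg 0 = n ∧ t.time ≤ s.time + P.cost.eval n := by
  induction P generalizing s with
  | store => exact hP.elim
  | gate g q =>
    intro t ht
    simp only [Program.exec] at ht
    split at ht <;> simp_all [Branch.tick, Branch.mapVec, Program.cost]
  | cnot q q' =>
    intro t ht
    simp only [Program.exec] at ht
    split at ht <;> simp_all [Branch.tick, Branch.mapVec, Program.cost]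
  | measure q r =>
    intro t ht
    simp only [Program.exec] at ht
    have hr : r ≠ 0 := hP
    split at ht
    · simp only [List.mem_cons, List.not_mem_nil, or_false] at ht
      rcases ht with rfl | rfl <;>
        simp [Branch.tick, Branch.mapVec, Branch.write, Program.cost, hs, hr.symm]
    · simp only [List.mem_singleton] at ht
      subst ht
      simp [Branch.tick, Branch.write, Program.cost, hs, hr.symm]
  | seq P Q ihP ihQ =>
    intro t ht
    simp only [Program.exec, List.mem_flatMap] at ht
    obtain ⟨u, hu, ht⟩ := ht
    have h1 := ihP hP.1 s hs u hu
    have h2 := ihQ hP.2 u h1.1 t ht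
    refine ⟨h2.1, ?_⟩
    simp only [Program.cost, Polynomial.eval_add]
    omega
  | ifZero r P Q ihP ihQ =>
    intro t ht
    simp only [Program.exec] at ht
    simp only [Program.cost, Polynomial.eval_add, Polynomial.eval_one]
    split at ht
    · have := ihP hP.1 s.tick hs t ht
      simp only [Branch.tick] at this
      omega
    · have := ihQ hP.2 s.tick hs t ht
      simp only [Branch.tick] at this
      omega
  | loop r P ih =>
    obtain ⟨rfl, hP⟩ := hP
    have key : ∀ m : ℕ, ∀ t ∈ (fun L : List (Branch n a) => L.flatMap fun t => P.exec U t.tick)^[m]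
        [s.tick], t.reg 0 = n ∧ t.time ≤ s.time + 1 + m * (1 + P.cost.eval n) := by
      intro m
      induction m with
      | zero =>
        intro t ht
        simp only [Function.iterate_zero, id_eq, List.mem_singleton] at ht
        subst ht
        simp [Branch.tick, hs]
      | succ m ihm =>
        intro t ht
        rw [Function.iterate_succ_apply'] at ht
        obtain ⟨u, hu, ht⟩ := List.mem_flatMap.mp ht
        have h1 := ihm u hu
        have h2 := ih hP u.tick h1.1 t ht
        refine ⟨h2.1, ?_⟩
        have h3 := h2.2
        simp only [Branch.tick] at h3
        rw [Nat.succ_mul]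
        omega
    intro t ht
    simp only [Program.exec, hs] at ht
    have := key n t ht
    simp only [Program.cost, Polynomial.eval_add, Polynomial.eval_one, Polynomial.eval_mul,
      Polynomial.eval_X]
    exact ⟨this.1, by omega⟩
  | query =>
    intro t ht
    simp only [Program.exec, List.mem_singleton] at ht
    subst ht
    simp [Branch.tick, Branch.mapVec, Program.cost, hs]
  | _ =>
    intro t ht
    simp only [Program.exec, List.mem_singleton] at ht
    subst ht
    simp only [Program.LoopsOverInput] at hP
    simp [Branch.tick, Branch.write, Program.cost, hs, Ne.symm hP]

/-! ### Predicate transformer semantics for machines without ancillas -/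

/-- A real function of the register contents and the (unnormalized) state of `n` qubits. -/
abbrev Observable (n : ℕ) : Type := (ℕ → ℕ) → (Bits n → ℂ) → ℝ

/-- The qubit with address `q` of a machine without ancillas. -/
def qubitAt (n q : ℕ) : Option (Fin n) := if h : q < n then some ⟨q, h⟩ else none

/-- Apply a single-qubit operator to the qubit `i`. -/
noncomputable def qubitGate {n : ℕ} (M : Matrix Bool Bool ℂ) (i : Fin n) (φ : Bits n → ℂ) : Bits n → ℂ :=
  fun x => ∑ c : Bool, M (x i) c * φ (Function.update x i c)

/-- Project the qubit `i` onto the outcome `o`. -/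
def qubitProject {n : ℕ} (i : Fin n) (o : Bool) (φ : Bits n → ℂ) : Bits n → ℂ :=
  fun x => if x i = o then φ x else 0

/-- The sum of an observable over the branches at the end of a program, as a function of the
initial branch. -/
noncomputable def Program.sem {n : ℕ} (U : Operator n) : Program → Observable n → Observable n
  | .const r c => fun F ρ φ => F (Function.update ρ r c) φ
  | .add r p q => fun F ρ φ => F (Function.update ρ r (ρ p + ρ q)) φ
  | .sub r p q => fun F ρ φ => F (Function.update ρ r (ρ p - ρ q)) φ
  | .load r p => fun F ρ φ => F (Function.update ρ r (ρ (ρ p))) φ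
  | .store r p => fun F ρ φ => F (Function.update ρ (ρ r) (ρ p)) φ
  | .gate g q => fun F ρ φ =>
      match qubitAt n (ρ q) with
      | some i => F ρ (qubitGate g.mat i φ)
      | none => F ρ φ
  | .cnot q q' => fun F ρ φ =>
      match qubitAt n (ρ q), qubitAt n (ρ q') with
      | some i, some j =>
        F ρ fun x => if i = j then φ x else φ (Function.update x j (xor (x j) (x i)))
      | _, _ => F ρ φ
  | .query => fun F ρ φ => F ρ (U.mulVec φ)
  | .measure q r => fun F ρ φ =>
      match qubitAt n (ρ q) with
      | some i => F (Function.update ρ r 0) (qubitProject i false φ) +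
          F (Function.update ρ r 1) (qubitProject i true φ)
      | none => F (Function.update ρ r 0) φ
  | .seq P Q => fun F => P.sem U (Q.sem U F)
  | .ifZero r P Q => fun F ρ φ => if ρ r = 0 then P.sem U F ρ φ else Q.sem U F ρ φ
  | .loop r P => fun F ρ φ => (P.sem U)^[ρ r] F ρ φ

/-! ### Reduction to vectors on the system qubits -/

/-- The basis label of all qubits of a machine without ancillas. -/
def wireBits {n : ℕ} (x : Bits n) : Wire n 0 → Bool := Sum.elim x fun j => j.elim0

/-- The state of the qubits of a machine without ancillas. -/
def sysVec {n : ℕ} (ψ : StateVec n 0) : Bits n → ℂ := fun x => ψ (wireBits x)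

theorem wireAt_zero (n q : ℕ) : wireAt n 0 q = (qubitAt n q).map Sum.inl := by
  unfold wireAt qubitAt
  by_cases h : q < n
  · have h' : q < n + 0 := h
    rw [dif_pos h', dif_pos h, Option.map_some, Option.some_inj, Equiv.symm_apply_eq]
    rfl
  · have h' : ¬ q < n + 0 := h
    rw [dif_neg h', dif_neg h]
    rfl

theorem update_wireBits {n : ℕ} (x : Bits n) (i : Fin n) (c : Bool) :
    Function.update (wireBits x) (Sum.inl i) c = wireBits (Function.update x i c) := by
  funext w
  rcases w with w | w
  · by_cases h : w = i
    · subst h; simp [wireBits]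
    · simp [wireBits, h]
  · exact w.elim0

theorem sysVec_applyGate {n : ℕ} (M : Matrix Bool Bool ℂ) (i : Fin n) (ψ : StateVec n 0) :
    sysVec (applyGate M (Sum.inl i) ψ) = qubitGate M i (sysVec ψ) := by
  funext x
  simp only [sysVec, applyGate, qubitGate, update_wireBits]
  rfl

theorem sysVec_project {n : ℕ} (i : Fin n) (o : Bool) (ψ : StateVec n 0) :
    sysVec (project (Sum.inl i) o ψ) = qubitProject i o (sysVec ψ) := rfl

theorem sysVec_applyOracle {n : ℕ} (U : Operator n) (ψ : StateVec n 0) :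
    sysVec (applyOracle U ψ) = U.mulVec (sysVec ψ) := by
  funext x
  simp only [sysVec, applyOracle, Matrix.mulVec, dotProduct]
  refine Finset.sum_congr rfl fun y _ => ?_
  congr 2

theorem sysVec_applyCNOT {n : ℕ} (i j : Fin n) (ψ : StateVec n 0) :
    sysVec (applyCNOT (Sum.inl i) (Sum.inl j) ψ) =
      fun x => if i = j then sysVec ψ x else sysVec ψ (Function.update x j (xor (x j) (x i))) := by
  funext x
  simp only [sysVec, applyCNOT, update_wireBits, Sum.inl.injEq]
  rfl

theorem sum_map_flatMap {α β : Type*} (L : List α) (f : α → List β) (g : β → ℝ) :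
    ((L.flatMap f).map g).sum = (L.map fun a => ((f a).map g).sum).sum := by
  induction L with
  | nil => rfl
  | cons a L ih => simp [ih]

/-- Branches are produced forwards while observables are pulled back; linearity of the sum over
branches matches the two. Elapsed time drops out because observables do not see it. -/
theorem Program.sum_exec {n : ℕ} (U : Operator n) (P : Program) (F : Observable n)
    (s : Branch n 0) :
    ((P.exec U s).map fun t => F t.reg (sysVec t.vec)).sum = P.sem U F s.reg (sysVec s.vec) := by
  induction P generalizing F s with
  | gate g q =>
    simp only [Program.exec, Program.sem, wireAt_zero]
    cases qubitAt n (s.reg q) <;> simp [Branch.tick, Branch.mapVec, sysVec_applyGate]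
  | cnot q q' =>
    simp only [Program.exec, Program.sem, wireAt_zero]
    cases qubitAt n (s.reg q) <;> cases qubitAt n (s.reg q') <;>
      simp [Branch.tick, Branch.mapVec, sysVec_applyCNOT]
  | measure q r =>
    simp only [Program.exec, Program.sem, wireAt_zero]
    cases qubitAt n (s.reg q) <;>
      simp [Branch.tick, Branch.mapVec, Branch.write, sysVec_project]
  | query => simp [Program.exec, Program.sem, Branch.tick, Branch.mapVec, sysVec_applyOracle]
  | seq P Q ihP ihQ => simp only [Program.exec, Program.sem, sum_map_flatMap, ihQ, ihP]
  | ifZero r P Q ihP ihQ =>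
    simp only [Program.exec, Program.sem]
    split
    · exact ihP F s.tick
    · exact ihQ F s.tick
  | loop r P ih =>
    -- The list is arbitrary because one pass turns a single branch into many. The pass executed
    -- first is the outermost application of `P.sem U`.
    have key : ∀ (m : ℕ) (L : List (Branch n 0)),
        (((fun L : List (Branch n 0) => L.flatMap fun t => P.exec U t.tick)^[m] L).map
          fun t => F t.reg (sysVec t.vec)).sum =
        (L.map fun t => (P.sem U)^[m] F t.reg (sysVec t.vec)).sum := by
      intro m
      induction m with
      | zero => intro L; rfl
      | succ m ihm =>
        intro L
        rw [Function.iterate_succ_apply, ihm, sum_map_flatMap, Function.iterate_succ_apply']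
        congr 1
        refine List.map_congr_left fun t _ => ?_
        exact ih _ t.tick
    simp only [Program.exec, Program.sem]
    rw [key]
    simp [Branch.tick]
  | _ => simp [Program.exec, Program.sem, Branch.tick, Branch.write]

/-- The squared norm of a vector. -/
noncomputable def normSq {n : ℕ} (φ : Bits n → ℂ) : ℝ := ∑ x, ‖φ x‖ ^ 2

theorem Branch.weight_eq {n : ℕ} (s : Branch n 0) : s.weight = normSq (sysVec s.vec) := by
  let e : (Wire n 0 → Bool) ≃ Bits n :=
    { toFun := fun b i => b (Sum.inl i)
      invFun := wireBits
      left_inv := fun b => by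
        funext w
        rcases w with w | w
        · rfl
        · exact w.elim0
      right_inv := fun x => rfl }
  exact (Equiv.sum_comp e.symm fun b => ‖s.vec b‖ ^ 2).symm

/-- The state `|0⋯0⟩`. -/
noncomputable def zeroVec (n : ℕ) : Bits n → ℂ := Pi.single (fun _ => false) 1

theorem sysVec_single (n : ℕ) :
    sysVec (Pi.single (fun _ => false) 1 : StateVec n 0) = zeroVec n := by
  funext x
  have : wireBits x = (fun _ => false) ↔ x = fun _ => false := by
    constructor
    · intro h
      funext i
      exact congrFun h (Sum.inl i)
    · rintro rfl
      funext w
      rcases w with w | w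
      · rfl
      · exact w.elim0
  simp only [sysVec, zeroVec, Pi.single_apply, this]

/-- The weight of the branches with content `1` of register `1`. -/
noncomputable def acceptObservable (n : ℕ) : Observable n := fun ρ φ => if ρ 1 = 1 then normSq φ else 0

theorem OracleAlgorithm.acceptProb_eq (P : Program) (n : ℕ) (U : UnitaryOp n) :
    (OracleAlgorithm.mk P 0).acceptProb n U =
      P.sem (U : Operator n) (acceptObservable n) (Function.update (fun _ => 0) 0 n) (zeroVec n) := by
  -- The number of ancillas is the value of the zero polynomial, which is `0` only propositionally;
  -- generalizing it allows substitution in the type of branches.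
  have key : ∀ (a : ℕ) (_ : a = 0) (s : Branch n a)
      (_ : s = ⟨Function.update (fun _ => 0) 0 n, 0, Pi.single (fun _ => false) 1⟩),
      (((P.exec (U : Operator n) s).filter fun s => s.reg 1 = 1).map Branch.weight).sum =
        P.sem (U : Operator n) (acceptObservable n) (Function.update (fun _ => 0) 0 n)
          (zeroVec n) := by
    rintro a rfl s rfl
    have h := P.sum_exec (U : Operator n) (acceptObservable n)
      (⟨Function.update (fun _ => 0) 0 n, 0, Pi.single (fun _ => false) 1⟩ : Branch n 0)
    rw [sysVec_single] at h
    rw [← h]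
    generalize P.exec (U : Operator n) _ = L
    induction L with
    | nil => rfl
    | cons t L ih =>
      by_cases ht : t.reg 1 = 1
      · simp [ht, ih, acceptObservable, Branch.weight_eq]
      · simp [ht, ih, acceptObservable]
  exact key _ Polynomial.eval_zero _ rfl

/-! ### Tensor products of single-qubit operators -/

/-- The tensor product of single-qubit operators. -/
def tens {n : ℕ} (f : Fin n → Matrix Bool Bool ℂ) : Operator n :=
  Matrix.of fun x y => ∏ i, f i (x i) (y i)

theorem tens_apply {n : ℕ} (f : Fin n → Matrix Bool Bool ℂ) (x y : Bits n) :
    tens f x y = ∏ i, f i (x i) (y i) := rfl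

theorem sum_prod_bits {n : ℕ} {κ R : Type*} [Fintype κ] [DecidableEq κ] [CommSemiring R]
    (f : Fin n → κ → R) :
    ∑ x : Fin n → κ, ∏ i, f i (x i) = ∏ i, ∑ c, f i c := by
  rw [Finset.prod_univ_sum, Fintype.piFinset_univ]

theorem tens_mul {n : ℕ} (f g : Fin n → Matrix Bool Bool ℂ) :
    tens f * tens g = tens fun i => f i * g i := by
  ext x y
  simp only [Matrix.mul_apply, tens_apply, ← Finset.prod_mul_distrib]
  exact sum_prod_bits fun i c => f i (x i) c * g i c (y i)

theorem tens_one {n : ℕ} : tens (fun _ : Fin n => (1 : Matrix Bool Bool ℂ)) = 1 := by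
  ext x y
  rw [tens_apply]
  by_cases h : x = y
  · subst h; simp
  · obtain ⟨i, hi⟩ := Function.ne_iff.mp h
    rw [Matrix.one_apply_ne h]
    exact Finset.prod_eq_zero (Finset.mem_univ i) (Matrix.one_apply_ne hi)

theorem tens_conjTranspose {n : ℕ} (f : Fin n → Matrix Bool Bool ℂ) :
    (tens f).conjTranspose = tens fun i => (f i).conjTranspose := by
  ext x y
  simp [tens_apply, Matrix.conjTranspose_apply]

theorem tens_smul {n : ℕ} (c : Fin n → ℂ) (f : Fin n → Matrix Bool Bool ℂ) :
    (tens fun i => c i • f i) = (∏ i, c i) • tens f := by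
  ext x y
  simp [tens_apply, Finset.prod_mul_distrib]

theorem trace_tens {n : ℕ} (f : Fin n → Matrix Bool Bool ℂ) :
    (tens f).trace = ∏ i, (f i).trace := by
  simp only [Matrix.trace, Matrix.diag, tens_apply]
  exact sum_prod_bits fun i c => f i c c

theorem tens_mem_unitaryGroup {n : ℕ} {f : Fin n → Matrix Bool Bool ℂ}
    (hf : ∀ i, f i ∈ Matrix.unitaryGroup Bool ℂ) : tens f ∈ Matrix.unitaryGroup (Bits n) ℂ := by
  rw [Matrix.mem_unitaryGroup_iff, Matrix.star_eq_conjTranspose, tens_conjTranspose, tens_mul,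
    ← tens_one]
  congr 1
  funext i
  exact Matrix.mem_unitaryGroup_iff.mp (hf i)

/-- The entry at `x`, `y` vanishes unless `y` agrees with `x` off `i`, so the row sum reduces to two
terms. -/
theorem tens_update_mulVec {n : ℕ} (M : Matrix Bool Bool ℂ) (i : Fin n) (φ : Bits n → ℂ) :
    (tens (Function.update (fun _ => 1) i M)).mulVec φ = qubitGate M i φ := by
  funext x
  simp only [Matrix.mulVec, dotProduct, qubitGate]
  have hinj : Function.Injective fun c : Bool => Function.update x i c :=
    Function.update_injective x i
  rw [← Finset.sum_subset (Finset.subset_univ (Finset.univ.map ⟨_, hinj⟩)), Finset.sum_map]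
  · refine Finset.sum_congr rfl fun c _ => ?_
    simp only [Function.Embedding.coeFn_mk, tens_apply]
    congr 1
    rw [Finset.prod_eq_single i]
    · simp
    · intro j _ hj
      simp [hj]
    · simp
  · intro y _ hy
    have : ∃ j, j ≠ i ∧ x j ≠ y j := by
      by_contra! h
      apply hy
      simp only [Finset.mem_map, Finset.mem_univ, Function.Embedding.coeFn_mk, true_and]
      refine ⟨y i, ?_⟩
      funext j
      by_cases hj : j = i
      · subst hj; simp
      · simp [hj, h j hj]
    obtain ⟨j, hj, hxy⟩ := this
    rw [tens_apply, Finset.prod_eq_zero (Finset.mem_univ j), zero_mul]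
    simp [hj, hxy]

/-! ### Pauli operators -/

/-- Labels of the single-qubit Pauli operators. -/
inductive Pauli : Type
  | I
  | X
  | Y
  | Z
  deriving DecidableEq

instance : Fintype Pauli := ⟨{.I, .X, .Y, .Z}, fun p => by cases p <;> decide⟩

/-- The matrix of a Pauli operator. -/
def Pauli.mat : Pauli → Matrix Bool Bool ℂ
  | .I => 1
  | .X => Matrix.of fun b c => if b = c then 0 else 1
  | .Y => Matrix.of fun b c => if b = c then 0 else if b then Complex.I else -Complex.I
  | .Z => Matrix.of fun b c => if b = c then (if b then -1 else 1) else 0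

/-- The sign relating the two products of a pair of Pauli operators. -/
def Pauli.sign (p q : Pauli) : ℤ := if p = .I ∨ q = .I ∨ p = q then 1 else -1

theorem Pauli.mat_mul_comm (p q : Pauli) :
    p.mat * q.mat = (p.sign q : ℂ) • (q.mat * p.mat) := by
  ext a b
  cases p <;> cases q <;> cases a <;> cases b <;>
    simp [Pauli.mat, Pauli.sign, Matrix.mul_apply]

theorem Pauli.mat_mul_self (p : Pauli) : p.mat * p.mat = 1 := by
  ext a b
  cases p <;> cases a <;> cases b <;> simp [Pauli.mat, Matrix.mul_apply]

theorem Pauli.mat_conjTranspose (p : Pauli) : p.mat.conjTranspose = p.mat := by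
  ext a b
  cases p <;> cases a <;> cases b <;> simp [Pauli.mat, Matrix.conjTranspose_apply]

theorem Pauli.trace_mat {p : Pauli} (hp : p ≠ .I) : p.mat.trace = 0 := by
  cases p <;> simp_all [Pauli.mat, Matrix.trace]

theorem Pauli.sum_eq {R : Type*} [AddCommMonoid R] (f : Pauli → R) :
    ∑ p, f p = f .I + (f .X + (f .Y + f .Z)) := by
  have : (Finset.univ : Finset Pauli) = {.I, .X, .Y, .Z} := by decide
  rw [this, Finset.sum_insert (by decide), Finset.sum_insert (by decide),
    Finset.sum_insert (by decide), Finset.sum_singleton]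

/-- The sum of p ⊗ p over the Pauli operators is twice the swap; the n-qubit expansion factorizes
into this identity. -/
theorem Pauli.completeness (a b c d : Bool) :
    ∑ p : Pauli, p.mat b a * p.mat c d = if a = c ∧ b = d then 2 else 0 := by
  rw [Pauli.sum_eq]
  cases a <;> cases b <;> cases c <;> cases d <;> simp [Pauli.mat] <;> norm_num

theorem Pauli.sum_sign {p : Pauli} (hp : p ≠ .I) : ∑ q : Pauli, p.sign q = 0 := by
  revert hp; revert p; decide

/-- The tensor product of the Pauli operators with labels `l`. -/
def pauliOp {n : ℕ} (l : Fin n → Pauli) : Operator n := tens fun i => (l i).mat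

theorem pauliOp_mul_self {n : ℕ} (l : Fin n → Pauli) : pauliOp l * pauliOp l = 1 := by
  simp only [pauliOp, tens_mul, Pauli.mat_mul_self, tens_one]

theorem pauliOp_conjTranspose {n : ℕ} (l : Fin n → Pauli) :
    (pauliOp l).conjTranspose = pauliOp l := by
  simp only [pauliOp, tens_conjTranspose, Pauli.mat_conjTranspose]

theorem pauliOp_I (n : ℕ) : pauliOp (fun _ : Fin n => Pauli.I) = 1 := tens_one

theorem trace_pauliOp {n : ℕ} {l : Fin n → Pauli} (hl : ∃ i, l i ≠ .I) :
    (pauliOp l).trace = 0 := by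
  obtain ⟨i, hi⟩ := hl
  rw [pauliOp, trace_tens]
  exact Finset.prod_eq_zero (Finset.mem_univ i) (Pauli.trace_mat hi)

/-- The sign relating the two products of a pair of Pauli strings. -/
def pauliSign {n : ℕ} (l m : Fin n → Pauli) : ℤ := ∏ i, (l i).sign (m i)

theorem pauliOp_mul_comm {n : ℕ} (l m : Fin n → Pauli) :
    pauliOp l * pauliOp m = (pauliSign l m : ℂ) • (pauliOp m * pauliOp l) := by
  simp only [pauliOp, tens_mul, pauliSign, Int.cast_prod, ← tens_smul]
  congr 1
  funext i
  exact Pauli.mat_mul_comm _ _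

theorem pauliSign_eq {n : ℕ} (l m : Fin n → Pauli) : pauliSign l m = 1 ∨ pauliSign l m = -1 := by
  unfold pauliSign
  refine Finset.prod_induction _ (fun z : ℤ => z = 1 ∨ z = -1) ?_ (Or.inl rfl) ?_
  · rintro a b (rfl | rfl) (rfl | rfl) <;> simp
  · intro i _
    unfold Pauli.sign
    split <;> simp

/-- A non-identity Pauli operator commutes with two of the four and anticommutes with the other two.
Hence a non-identity string anticommutes with exactly half of all strings. -/
theorem sum_pauliSign {n : ℕ} {l : Fin n → Pauli} (hl : ∃ i, l i ≠ .I) :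
    ∑ m, pauliSign l m = 0 := by
  obtain ⟨i, hi⟩ := hl
  simp only [pauliSign]
  rw [sum_prod_bits fun i q => (l i).sign q]
  exact Finset.prod_eq_zero (Finset.mem_univ i) (Pauli.sum_sign hi)

/-- Entrywise, the sum over strings is a product over qubits of completeness relations, which
selects the single entry `A u v` with weight 2ⁿ. -/
theorem pauli_expansion {n : ℕ} (A : Operator n) :
    ∑ l : Fin n → Pauli, (pauliOp l * A).trace • pauliOp l = (2 ^ n : ℂ) • A := by
  ext u v
  have h1 : ∀ l : Fin n → Pauli, (pauliOp l * A).trace * pauliOp l u v =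
      ∑ y, ∑ x, A x y * ∏ i, ((l i).mat (y i) (x i) * (l i).mat (u i) (v i)) := by
    intro l
    simp only [Matrix.trace, Matrix.diag, Matrix.mul_apply, Finset.sum_mul]
    refine Finset.sum_congr rfl fun y _ => Finset.sum_congr rfl fun x _ => ?_
    rw [Finset.prod_mul_distrib, pauliOp, tens_apply, tens_apply]
    ring
  have h2 : ∀ x y : Bits n,
      ∏ i, ∑ p : Pauli, p.mat (y i) (x i) * p.mat (u i) (v i) =
        if x = u ∧ y = v then (2 ^ n : ℂ) else 0 := by
    intro x y
    simp only [Pauli.completeness]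
    split_ifs with h
    · obtain ⟨rfl, rfl⟩ := h
      simp
    · have : ∃ i, ¬ (x i = u i ∧ y i = v i) := by
        by_contra! h'
        exact h ⟨funext fun i => (h' i).1, funext fun i => (h' i).2⟩
      obtain ⟨i, hi⟩ := this
      exact Finset.prod_eq_zero (Finset.mem_univ i) (if_neg hi)
  simp only [Matrix.sum_apply, Matrix.smul_apply, smul_eq_mul, h1]
  rw [Finset.sum_comm, Finset.sum_eq_single v]
  · rw [Finset.sum_comm, Finset.sum_eq_single u]
    · rw [← Finset.mul_sum, sum_prod_bits fun i (p : Pauli) => p.mat (v i) (u i) * p.mat (u i) (v i),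
        h2, if_pos ⟨rfl, rfl⟩, mul_comm]
    · intro x _ hx
      rw [← Finset.mul_sum, sum_prod_bits fun i (p : Pauli) => p.mat (v i) (x i) * p.mat (u i) (v i),
        h2, if_neg fun h => hx h.1, mul_zero]
    · simp
  · intro y _ hy
    rw [Finset.sum_comm]
    refine Finset.sum_eq_zero fun x _ => ?_
    rw [← Finset.mul_sum, sum_prod_bits fun i (p : Pauli) => p.mat (y i) (x i) * p.mat (u i) (v i),
        h2, if_neg fun h => hy h.2, mul_zero]
  · simp

/-- Pair the expansion of `A` with its adjoint and take traces; Pauli strings are Hermitian, so the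
coefficients of the adjoint are the conjugates. -/
theorem pauli_parseval {n : ℕ} (A : Operator n) :
    ∑ l : Fin n → Pauli, ‖(pauliOp l * A).trace‖ ^ 2 =
      2 ^ n * (A * A.conjTranspose).trace.re := by
  have h := congrArg (fun B => (B * A.conjTranspose).trace) (pauli_expansion A)
  simp only [Finset.sum_mul, Matrix.trace_sum, Matrix.smul_mul, Matrix.trace_smul,
    smul_eq_mul] at h
  have h1 : ∀ l : Fin n → Pauli, (pauliOp l * A.conjTranspose).trace =
      (starRingEnd ℂ) (pauliOp l * A).trace := by
    intro l
    rw [starRingEnd_apply, ← Matrix.trace_conjTranspose, Matrix.conjTranspose_mul,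
      pauliOp_conjTranspose, Matrix.trace_mul_comm]
  simp only [h1, Complex.mul_conj, Complex.normSq_eq_norm_sq] at h
  have h2 := congrArg Complex.re h
  rw [← Complex.ofReal_sum, Complex.ofReal_re] at h2
  rw [h2]
  have : ((2 : ℂ) ^ n) = ((2 ^ n : ℝ) : ℂ) := by push_cast; rfl
  rw [this, Complex.re_ofReal_mul]

/-- Flipping bit `i` in both indices preserves `A`, which is the identity on qubit `i`. Where `A`
can be nonzero the two indices agree at `i`, and there a non-identity Pauli factor changes sign: Z
is odd under the flip, X and Y have zero diagonal. So the trace equals its negative. -/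
theorem ActsOn.trace_pauliOp_mul {n : ℕ} {S : Finset (Fin n)} {A : Operator n} (hA : ActsOn S A)
    {l : Fin n → Pauli} {i : Fin n} (hi : i ∉ S) (hl : l i ≠ .I) :
    (pauliOp l * A).trace = 0 := by
  obtain ⟨B, hB⟩ := hA
  let e : Bits n ≃ Bits n := Function.Involutive.toPerm
    (fun x => Function.update x i (!(x i))) (fun x => by simp)
  have he : ∀ x, e x = Function.update x i (!(x i)) := fun _ => rfl
  have hAe : ∀ x y, A (e x) (e y) = A x y := by
    intro x y
    rw [hB, hB]
    have h1 : (∀ j, j ∉ S → e x j = e y j) ↔ ∀ j, j ∉ S → x j = y j := by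
      refine forall_congr' fun j => imp_congr_right fun _ => ?_
      by_cases hj : j = i
      · subst hj; simp [he]
      · simp [he, hj]
    have h2 : ∀ z : Bits n, (fun j : S => e z j) = fun j : S => z j := by
      intro z
      funext j
      have : (j : Fin n) ≠ i := fun h => hi (h ▸ j.2)
      simp [he, this]
    simp only [h1, h2]
  have hT : (pauliOp l * A).trace = ∑ y, ∑ x, pauliOp l y x * A x y := by
    simp only [Matrix.trace, Matrix.diag, Matrix.mul_apply]
  have hneg : ∀ x y, pauliOp l (e y) (e x) * A x y = - (pauliOp l y x * A x y) := by
    intro x y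
    by_cases hxy : x i = y i
    · have : pauliOp l (e y) (e x) = - pauliOp l y x := by
        simp only [pauliOp, tens_apply]
        rw [← Finset.mul_prod_erase _ _ (Finset.mem_univ i),
          ← Finset.mul_prod_erase Finset.univ (fun j => (l j).mat (y j) (x j)) (Finset.mem_univ i),
          ← neg_mul]
        congr 1
        · simp only [he, Function.update_self, hxy]
          cases hli : l i <;> cases y i <;> simp_all [Pauli.mat]
        · refine Finset.prod_congr rfl fun j hj => ?_
          simp [he, Finset.ne_of_mem_erase hj]
      rw [this, neg_mul]
    · have : A x y = 0 := by
        rw [hB, if_neg]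
        exact fun h => hxy (h i hi)
      simp [this]
  have hsum : (pauliOp l * A).trace = - (pauliOp l * A).trace := by
    conv_lhs => rw [hT]
    rw [← Equiv.sum_comp e]
    simp only [← Equiv.sum_comp e (fun x => pauliOp l (e _) x * A x (e _)), hAe, hneg]
    rw [hT]
    simp only [Finset.sum_neg_distrib]
  exact self_eq_neg.mp hsum

/-! ### Correlators of a unitary -/

/-- The correlator `2⁻ⁿ tr (P U Q U†)` of the Pauli strings `P`, `Q` with labels `l`, `m`. -/
noncomputable def corr {n : ℕ} (U : Operator n) (l m : Fin n → Pauli) : ℝ :=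
  (pauliOp l * (U * pauliOp m * U.conjTranspose)).trace.re / 2 ^ n

/-- A trace of a product of two Hermitian operators is real, so taking the real part in `corr` loses
nothing. -/
theorem ofReal_corr {n : ℕ} (U : Operator n) (l m : Fin n → Pauli) :
    ((2 ^ n * corr U l m : ℝ) : ℂ) = (pauliOp l * (U * pauliOp m * U.conjTranspose)).trace := by
  have h : (starRingEnd ℂ) (pauliOp l * (U * pauliOp m * U.conjTranspose)).trace =
      (pauliOp l * (U * pauliOp m * U.conjTranspose)).trace := by
    rw [starRingEnd_apply, ← Matrix.trace_conjTranspose, Matrix.conjTranspose_mul,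
      pauliOp_conjTranspose, Matrix.trace_mul_comm]
    simp only [Matrix.conjTranspose_mul, Matrix.conjTranspose_conjTranspose,
      pauliOp_conjTranspose, Matrix.mul_assoc]
  rw [corr, mul_div_cancel₀ _ (by positivity)]
  exact Complex.conj_eq_iff_re.mp h

/-- Parseval for the unitary operator U Q U†, whose squared Hilbert–Schmidt norm is 2ⁿ. -/
theorem sum_corr_sq {n : ℕ} (U : UnitaryOp n) (m : Fin n → Pauli) :
    ∑ l, corr (U : Operator n) l m ^ 2 = 1 := by
  have h := pauli_parseval ((U : Operator n) * pauliOp m * (U : Operator n).conjTranspose)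
  have hU : (U : Operator n).conjTranspose * (U : Operator n) = 1 :=
    Matrix.mem_unitaryGroup_iff'.mp U.2
  have hU' : (U : Operator n) * (U : Operator n).conjTranspose = 1 :=
    Matrix.mem_unitaryGroup_iff.mp U.2
  have h1 : (U : Operator n) * pauliOp m * (U : Operator n).conjTranspose *
      ((U : Operator n) * pauliOp m * (U : Operator n).conjTranspose).conjTranspose = 1 := by
    simp only [Matrix.conjTranspose_mul, Matrix.conjTranspose_conjTranspose, pauliOp_conjTranspose]
    calc (U : Operator n) * pauliOp m * (U : Operator n).conjTranspose *
          ((U : Operator n) * (pauliOp m * (U : Operator n).conjTranspose))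
        = (U : Operator n) * (pauliOp m * ((U : Operator n).conjTranspose * (U : Operator n)) *
          pauliOp m) * (U : Operator n).conjTranspose := by simp only [Matrix.mul_assoc]
      _ = 1 := by rw [hU, Matrix.mul_one, pauliOp_mul_self, Matrix.mul_one, hU']
  rw [h1, Matrix.trace_one] at h
  simp only [← ofReal_corr, Complex.norm_real, Real.norm_eq_abs, sq_abs, mul_pow,
    ← Finset.mul_sum] at h
  have h2 : ((2 : ℝ) ^ n) ^ 2 ≠ 0 := by positivity
  apply mul_left_cancel₀ h2
  rw [h]
  simp only [Fintype.card_pi, Fintype.card_bool, Finset.prod_const, Finset.card_univ,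
    Fintype.card_fin, Complex.natCast_re]
  push_cast
  ring

theorem corr_sq_le_one {n : ℕ} (U : UnitaryOp n) (l m : Fin n → Pauli) :
    corr (U : Operator n) l m ^ 2 ≤ 1 := by
  rw [← sum_corr_sq U m]
  exact Finset.single_le_sum (f := fun l => corr (U : Operator n) l m ^ 2)
    (fun l _ => sq_nonneg _) (Finset.mem_univ l)

theorem continuous_corr {n : ℕ} (l m : Fin n → Pauli) :
    Continuous fun U : UnitaryOp n => corr (U : Operator n) l m := by
  unfold corr
  have h : Continuous fun U : UnitaryOp n => (U : Operator n) := continuous_subtype_val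
  refine Continuous.div_const (Complex.continuous_re.comp (Continuous.matrix_trace ?_)) _
  exact continuous_const.matrix_mul ((h.matrix_mul continuous_const).matrix_mul h.matrix_conjTranspose)

/-- The labels of the Pauli strings other than the identity that act on at most `k` qubits. -/
def localPaulis (n k : ℕ) : Finset (Fin n → Pauli) :=
  Finset.univ.filter fun l => (∃ i, l i ≠ .I) ∧ (Finset.univ.filter fun i => l i ≠ .I).card ≤ k

/-- The Pauli coefficients of H off the identity form a nonzero vector fixed by the local block of
the correlator matrix. A matrix with a nonzero fixed vector has Frobenius norm at least one. -/
theorem one_le_sum_corr_sq {n k d : ℕ} {H : Operator n} (hH : IsLocalHamiltonian k d H)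
    (hscal : ∀ c : ℂ, H ≠ c • (1 : Operator n)) (U : UnitaryOp n)
    (hU : Commute (U : Operator n) H) :
    1 ≤ ∑ l ∈ localPaulis n k, ∑ m ∈ localPaulis n k, corr (U : Operator n) l m ^ 2 := by
  set c : (Fin n → Pauli) → ℂ := fun l => (pauliOp l * H).trace with hc
  have h2n : (2 : ℂ) ^ n ≠ 0 := pow_ne_zero _ two_ne_zero
  have hU' : (U : Operator n) * (U : Operator n).conjTranspose = 1 :=
    Matrix.mem_unitaryGroup_iff.mp U.2
  have hconj : (U : Operator n) * H * (U : Operator n).conjTranspose = H := by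
    rw [hU.eq, Matrix.mul_assoc, hU', Matrix.mul_one]
  have hsupp : ∀ l, c l ≠ 0 → (Finset.univ.filter fun i => l i ≠ .I).card ≤ k := by
    intro l hl
    obtain ⟨N, S, h, hS, -, rfl⟩ := hH
    have : ∃ a, (pauliOp l * h a).trace ≠ 0 := by
      by_contra! h0
      apply hl
      simp only [hc, Finset.mul_sum, Matrix.trace_sum, h0, Finset.sum_const_zero]
    obtain ⟨a, ha⟩ := this
    refine (Finset.card_le_card fun i hi => ?_).trans (hS a).2.1
    by_contra hiS
    exact ha ((hS a).2.2.trace_pauliOp_mul hiS (Finset.mem_filter.mp hi).2)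
  have hlin : ∀ l ∈ localPaulis n k,
      c l = ∑ m ∈ localPaulis n k, (corr (U : Operator n) l m : ℂ) * c m := by
    intro l hl
    have hl' := (Finset.mem_filter.mp hl).2
    have hexp := pauli_expansion H
    -- Replace H by U H U† and expand the inner H in Pauli strings.
    have h1 : (2 : ℂ) ^ n * c l = ∑ m, (2 : ℂ) ^ n * ((corr (U : Operator n) l m : ℂ) * c m) := by
      calc (2 : ℂ) ^ n * c l
          = (pauliOp l * ((U : Operator n) * ((2 ^ n : ℂ) • H) *
              (U : Operator n).conjTranspose)).trace := by
            rw [Matrix.mul_smul, Matrix.smul_mul, hconj, Matrix.mul_smul, Matrix.trace_smul,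
              smul_eq_mul]
        _ = _ := by
            rw [← hexp]
            simp only [Finset.mul_sum, Finset.sum_mul, Matrix.trace_sum, Matrix.mul_smul,
              Matrix.smul_mul, Matrix.trace_smul, smul_eq_mul, ← ofReal_corr]
            refine Finset.sum_congr rfl fun m _ => ?_
            push_cast
            ring
    rw [← Finset.mul_sum] at h1
    rw [mul_left_cancel₀ h2n h1]
    symm
    refine Finset.sum_subset (Finset.subset_univ _) fun m _ hm => ?_
    by_cases hmI : ∃ i, m i ≠ .I
    · have : c m = 0 := by
        by_contra h0
        exact hm (Finset.mem_filter.mpr ⟨Finset.mem_univ _, hmI, hsupp m h0⟩)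
      rw [this, mul_zero]
    -- The identity column vanishes: its correlator with l is a multiple of tr P_l = 0.
    · push Not at hmI
      have hm1 : pauliOp m = 1 := by
        rw [show m = fun _ => Pauli.I from funext hmI, pauliOp_I]
      have : corr (U : Operator n) l m = 0 := by
        rw [corr, hm1, Matrix.mul_one, hU', Matrix.mul_one, trace_pauliOp hl'.1]
        simp
      simp [this]
  have hpos : 0 < ∑ m ∈ localPaulis n k, ‖c m‖ ^ 2 := by
    have : ∃ m ∈ localPaulis n k, c m ≠ 0 := by
      by_contra! h0
      -- Were all local coefficients zero, only the identity term of the expansion would survive.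
      apply hscal ((2 ^ n : ℂ)⁻¹ * c fun _ => .I)
      rw [mul_smul, eq_inv_smul_iff₀ h2n, ← pauli_expansion H,
        Finset.sum_eq_single fun _ => Pauli.I]
      · simp only [hc, pauliOp_I]
      · intro m _ hm
        have hmI : ∃ i, m i ≠ .I := by
          by_contra! h'
          exact hm (funext h')
        have : c m = 0 := by
          by_contra h'
          exact h' (h0 m (Finset.mem_filter.mpr ⟨Finset.mem_univ _, hmI, hsupp m h'⟩))
        rw [show (pauliOp m * H).trace = c m from rfl, this, zero_smul]
      · simp
    obtain ⟨m, hm, hm0⟩ := this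
    exact Finset.sum_pos' (fun _ _ => by positivity) ⟨m, hm, by positivity⟩
  have hle : ∑ l ∈ localPaulis n k, ‖c l‖ ^ 2 ≤
      (∑ l ∈ localPaulis n k, ∑ m ∈ localPaulis n k, corr (U : Operator n) l m ^ 2) *
        ∑ m ∈ localPaulis n k, ‖c m‖ ^ 2 := by
    rw [Finset.sum_mul]
    refine Finset.sum_le_sum fun l hl => ?_
    have h1 : ‖c l‖ ≤ ∑ m ∈ localPaulis n k, |corr (U : Operator n) l m| * ‖c m‖ := by
      rw [hlin l hl]
      refine (norm_sum_le _ _).trans_eq (Finset.sum_congr rfl fun m _ => ?_)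
      rw [norm_mul, Complex.norm_real, Real.norm_eq_abs]
    calc ‖c l‖ ^ 2 ≤ (∑ m ∈ localPaulis n k, |corr (U : Operator n) l m| * ‖c m‖) ^ 2 := by gcongr
      _ ≤ (∑ m ∈ localPaulis n k, |corr (U : Operator n) l m| ^ 2) *
          ∑ m ∈ localPaulis n k, ‖c m‖ ^ 2 := Finset.sum_mul_sq_le_sq_mul_sq _ _ _
      _ = _ := by simp only [sq_abs]
  nlinarith

/-! ### Correlators of a Haar random unitary -/

instance (n : ℕ) : (haarEnsemble n).IsMulLeftInvariant :=
  inferInstanceAs (Measure.haarMeasure ⊤).IsMulLeftInvariant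

theorem integrable_of_continuous {n : ℕ} (μ : Measure (UnitaryOp n)) [IsFiniteMeasure μ]
    {f : UnitaryOp n → ℝ} (hf : Continuous f) : Integrable f μ := by
  obtain ⟨C, hC⟩ := isCompact_univ.exists_bound_of_continuousOn hf.continuousOn
  exact Integrable.of_bound hf.measurable.aestronglyMeasurable C
    (Filter.Eventually.of_forall fun U => hC U (Set.mem_univ U))

/-- Anticommuting Pauli strings are conjugate. -/
theorem exists_unitary_conj {n : ℕ} {l m : Fin n → Pauli} (h : pauliSign l m = -1) :
    ∃ V : UnitaryOp n, (V : Operator n).conjTranspose * pauliOp l * (V : Operator n) =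
      pauliOp m := by
  set P := pauliOp l
  set Q := pauliOp m
  have hPQ : Q * P = - (P * Q) := by
    rw [show P * Q = _ from pauliOp_mul_comm l m, h]
    simp [P, Q]
  have hPP : P * P = 1 := pauliOp_mul_self l
  have hQQ : Q * Q = 1 := pauliOp_mul_self m
  -- The normalized sum of two anticommuting Hermitian involutions is again a Hermitian involution,
  -- and it exchanges the two.
  set V : Operator n := ((Real.sqrt 2 : ℂ)⁻¹) • (P + Q) with hV
  have hs : (Real.sqrt 2 : ℂ)⁻¹ * (Real.sqrt 2 : ℂ)⁻¹ = 2⁻¹ := by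
    rw [← mul_inv, ← Complex.ofReal_mul, Real.mul_self_sqrt (by norm_num)]
    norm_num
  have hVV : V.conjTranspose = V := by
    rw [hV, Matrix.conjTranspose_smul, Matrix.conjTranspose_add]
    congr 1
    · simp
    · rw [show P.conjTranspose = P from pauliOp_conjTranspose l,
        show Q.conjTranspose = Q from pauliOp_conjTranspose m]
  have hmem : V ∈ Matrix.unitaryGroup (Bits n) ℂ := by
    rw [Matrix.mem_unitaryGroup_iff, Matrix.star_eq_conjTranspose, hVV, hV, Matrix.smul_mul,
      Matrix.mul_smul, smul_smul, hs, Matrix.add_mul, Matrix.mul_add, Matrix.mul_add, hPP, hQQ, hPQ]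
    rw [show (1 : Operator n) + P * Q + (-(P * Q) + 1) = (2 : ℂ) • 1 by rw [two_smul]; abel,
      smul_smul]
    norm_num
  refine ⟨⟨V, hmem⟩, ?_⟩
  simp only [hVV]
  rw [hV, Matrix.smul_mul, Matrix.smul_mul, Matrix.mul_smul, smul_smul, hs, Matrix.add_mul,
    Matrix.mul_add, Matrix.add_mul, Matrix.add_mul, hPP, hPQ, Matrix.one_mul, Matrix.one_mul,
    Matrix.neg_mul, Matrix.neg_mul, Matrix.mul_assoc P Q P, hPQ, Matrix.mul_neg,
    ← Matrix.mul_assoc P P Q, hPP, Matrix.one_mul, Matrix.mul_assoc P Q Q, hQQ, Matrix.mul_one]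
  rw [show P + -(-Q) + (Q + -P) = (2 : ℂ) • Q by rw [two_smul]; abel, smul_smul]
  norm_num

theorem corr_mul_left {n : ℕ} (V U : UnitaryOp n) {l l' : Fin n → Pauli} (m : Fin n → Pauli)
    (h : (V : Operator n).conjTranspose * pauliOp l * (V : Operator n) = pauliOp l') :
    corr ((V * U : UnitaryOp n) : Operator n) l m = corr (U : Operator n) l' m := by
  unfold corr
  rw [← h, Matrix.UnitaryGroup.mul_val, Matrix.conjTranspose_mul]
  congr 2
  calc (pauliOp l * ((V : Operator n) * (U : Operator n) * pauliOp m *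
        ((U : Operator n).conjTranspose * (V : Operator n).conjTranspose))).trace
      = ((pauliOp l * (V : Operator n) * ((U : Operator n) * pauliOp m *
          (U : Operator n).conjTranspose)) * (V : Operator n).conjTranspose).trace := by
        simp only [Matrix.mul_assoc]
    _ = _ := by
        rw [Matrix.trace_mul_comm]
        simp only [Matrix.mul_assoc]

/-- By left invariance the mean is the same for every string anticommuting with `l`. There are 4ⁿ/2
of these, and the means over all strings sum to one. -/
theorem integral_corr_sq_le {n : ℕ} {l : Fin n → Pauli} (hl : ∃ i, l i ≠ .I)
    (m : Fin n → Pauli) :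
    ∫ U, corr (U : Operator n) l m ^ 2 ∂(haarEnsemble n) ≤ 2 / 4 ^ n := by
  set a : (Fin n → Pauli) → ℝ := fun l => ∫ U, corr (U : Operator n) l m ^ 2 ∂(haarEnsemble n)
    with ha
  have ha0 : ∀ l, 0 ≤ a l := fun l => integral_nonneg fun U => sq_nonneg _
  have hsum : ∑ l, a l = 1 := by
    rw [ha, ← integral_finsetSum]
    · simp only [sum_corr_sq]
      simp
    · exact fun l _ => integrable_of_continuous _ ((continuous_corr l m).pow 2)
  have hconj : ∀ l', pauliSign l l' = -1 → a l' = a l := by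
    intro l' h
    obtain ⟨V, hV⟩ := exists_unitary_conj h
    have := integral_mul_left_eq_self (μ := haarEnsemble n)
      (fun U : UnitaryOp n => corr (U : Operator n) l m ^ 2) V
    simp only [corr_mul_left V _ m hV] at this
    exact this
  -- The weight (1 - sign)/2 is the indicator of anticommuting with `l`.
  have h1 : ∑ l', ((1 - pauliSign l l' : ℤ) : ℝ) / 2 * a l = ∑ l', ((1 - pauliSign l l' : ℤ) : ℝ) / 2 * a l' := by
    refine Finset.sum_congr rfl fun l' _ => ?_
    rcases pauliSign_eq l l' with h | h
    · simp [h]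
    · rw [hconj l' h]
  have h2 : ∑ l', ((1 - pauliSign l l' : ℤ) : ℝ) / 2 * a l' ≤ 1 := by
    rw [← hsum]
    refine Finset.sum_le_sum fun l' _ => ?_
    rcases pauliSign_eq l l' with h | h
    · simp [h, ha0]
    · simp [h]
  have h3 : ∑ l' : Fin n → Pauli, ((1 - pauliSign l l' : ℤ) : ℝ) / 2 * a l = 4 ^ n / 2 * a l := by
    rw [← Finset.sum_mul, ← Finset.sum_div, ← Int.cast_sum, Finset.sum_sub_distrib,
      sum_pauliSign hl]
    simp [Fintype.card_pi, show Fintype.card Pauli = 4 from rfl]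
  rw [le_div_iff₀ (by positivity)]
  have : (4 : ℝ) ^ n / 2 * a l ≤ 1 := by rw [← h3, h1]; exact h2
  linarith

/-! ### The program

Register `0` holds `n`, register `1` the output, register `2` the number one, register `3` a
measurement outcome, register `4` a parity, registers `5` and `6` the numbers of even and odd
parities, register `7` the number of repetitions, register `8` a qubit address. Registers from `10`
on hold the positions of the tensor factors of Pauli strings. A list of pairs of a register and a
Pauli label describes the Pauli string with these labels at the positions in these registers. -/

/-- Put all qubits into a uniformly random state of the computational basis. -/
def randomize : Program :=
  .seq (.const 8 0) (.loop 0 (.seq (.measure 8 3) (.seq (.gate .H 8)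
    (.seq (.measure 8 3) (.add 8 8 2)))))

/-- Measure a qubit and add the outcome to the parity. -/
def flipBy (r : ℕ) : Program := .seq (.measure r 3) (.ifZero 3 (.const 3 0) (.sub 4 2 4))

/-- Add the parity of the given qubits to the parity register and continue with `P`. -/
def flips (acc : List (ℕ × Pauli)) (P : Program) : Program :=
  acc.foldr (fun s Q => .seq (flipBy s.1) Q) P

/-- Apply gates to a qubit and continue with `P`. -/
def gateSeq (gs : List Gate) (r : ℕ) (P : Program) : Program :=
  gs.foldr (fun g Q => .seq (.gate g r) Q) P

/-- Apply to each of the given qubits the gates belonging to its label and continue with `P`. -/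
def slotGates (f : Pauli → List Gate) (acc : List (ℕ × Pauli)) (P : Program) : Program :=
  acc.foldr (fun s Q => gateSeq (f s.2) s.1 Q) P

/-- Gates that map the computational basis to the eigenbasis of a Pauli operator. -/
def Pauli.prep : Pauli → List Gate
  | .X => [.H]
  | .Y => [.H, .S]
  | _ => []

/-- Gates that map the eigenbasis of a Pauli operator to the computational basis. -/
def Pauli.rot : Pauli → List Gate
  | .X => [.H]
  | .Y => [.S, .S, .S, .H]
  | _ => []

/-- Prepare a random eigenstate of the Pauli string `accQ`, query the oracle, measure the Pauli
string `accP`, add the parity of both eigenvalues to the parity register and continue with `K`. -/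
def singleRun (accP accQ : List (ℕ × Pauli)) (K : Program) : Program :=
  .seq randomize (flips accQ (slotGates Pauli.prep accQ (.seq .query
    (slotGates Pauli.rot accP (flips accP K)))))

/-- Compare the results of two runs. -/
def compareRuns (accP accQ : List (ℕ × Pauli)) : Program :=
  .seq (.const 4 0) (singleRun accP accQ (singleRun accP accQ
    (.ifZero 4 (.add 5 5 2) (.add 6 6 2))))

/-- Write the first admissible position of the next tensor factor into register `r`. -/
def initSlot (r : ℕ) : List (ℕ × Pauli) → Program
  | [] => .const r 0
  | s :: _ => .add r s.1 2

/-- Run `body` on all Pauli strings with `m` further tensor factors, whose positions are written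
into the registers from `r` on. Positions increase; those outside the register are void. -/
def nest (body : List (ℕ × Pauli) → Program) : ℕ → ℕ → List (ℕ × Pauli) → Program
  | 0, _, acc => body acc
  | m + 1, r, acc => .seq (initSlot r acc) (.loop 0 (.seq (nest body m (r + 1) ((r, .X) :: acc))
      (.seq (nest body m (r + 1) ((r, .Y) :: acc))
        (.seq (nest body m (r + 1) ((r, .Z) :: acc)) (.add r r 2)))))

/-- Repeat a program `n ^ c` times. -/
def repeatPow : ℕ → Program → Program
  | 0, P => P
  | c + 1, P => .loop 0 (repeatPow c P)

/-- Accept if even parities outnumber odd ones by half of the number of repetitions. -/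
def decision : Program :=
  .seq (.add 6 6 6) (.seq (.add 6 6 7) (.seq (.add 5 5 5) (.seq (.sub 6 6 5)
    (.ifZero 6 (.const 1 1) (.const 1 0)))))

/-- Compare two runs for all pairs of Pauli strings with at most `K` tensor factors. -/
def allPairs (K : ℕ) : Program :=
  .seq (.add 7 7 2) (nest (fun accP => nest (fun accQ => compareRuns accP accQ) K (10 + K) [])
    K 10 [])

/-- The test whether a unitary has a conserved local observable. -/
def conservationTest (K c : ℕ) : Program :=
  .seq (.const 2 1) (.seq (repeatPow c (allPairs K)) decision)

/-! ### The program runs in polynomial time -/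

theorem loopsOverInput_flips {acc : List (ℕ × Pauli)} {P : Program} (hP : P.LoopsOverInput) :
    (flips acc P).LoopsOverInput := by
  induction acc with
  | nil => exact hP
  | cons s acc ih =>
    exact ⟨⟨(by decide : (3 : ℕ) ≠ 0), (by decide : (3 : ℕ) ≠ 0), (by decide : (4 : ℕ) ≠ 0)⟩, ih⟩

theorem loopsOverInput_gateSeq {gs : List Gate} {r : ℕ} {P : Program} (hP : P.LoopsOverInput) :
    (gateSeq gs r P).LoopsOverInput := by
  induction gs with
  | nil => exact hP
  | cons g gs ih => exact ⟨trivial, ih⟩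

theorem loopsOverInput_slotGates {f : Pauli → List Gate} {acc : List (ℕ × Pauli)} {P : Program}
    (hP : P.LoopsOverInput) : (slotGates f acc P).LoopsOverInput := by
  induction acc with
  | nil => exact hP
  | cons s acc ih => exact loopsOverInput_gateSeq ih

theorem loopsOverInput_singleRun {accP accQ : List (ℕ × Pauli)} {K : Program}
    (hK : K.LoopsOverInput) : (singleRun accP accQ K).LoopsOverInput := by
  refine ⟨?_, loopsOverInput_flips (loopsOverInput_slotGates ⟨trivial,
    loopsOverInput_slotGates (loopsOverInput_flips hK)⟩)⟩
  simp [randomize, Program.LoopsOverInput]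

theorem loopsOverInput_compareRuns (accP accQ : List (ℕ × Pauli)) :
    (compareRuns accP accQ).LoopsOverInput := by
  refine ⟨(by decide : (4 : ℕ) ≠ 0), loopsOverInput_singleRun (loopsOverInput_singleRun ?_)⟩
  simp [Program.LoopsOverInput]

theorem loopsOverInput_nest {body : List (ℕ × Pauli) → Program}
    (hbody : ∀ acc, (body acc).LoopsOverInput) (m r : ℕ) (hr : r ≠ 0) (acc : List (ℕ × Pauli)) :
    (nest body m r acc).LoopsOverInput := by
  induction m generalizing r acc with
  | zero => exact hbody acc
  | succ m ih =>
    have h := fun p => ih (r + 1) (Nat.succ_ne_zero r) ((r, p) :: acc)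
    refine ⟨?_, rfl, h _, h _, h _, hr⟩
    cases acc <;> exact hr

theorem loopsOverInput_repeatPow {P : Program} (hP : P.LoopsOverInput) (c : ℕ) :
    (repeatPow c P).LoopsOverInput := by
  induction c with
  | zero => exact hP
  | succ c ih => exact ⟨rfl, ih⟩

theorem loopsOverInput_conservationTest (K c : ℕ) :
    (conservationTest K c).LoopsOverInput := by
  have h : (allPairs K).LoopsOverInput := ⟨(by decide : (7 : ℕ) ≠ 0),
    loopsOverInput_nest (fun accP => loopsOverInput_nest
      (fun accQ => loopsOverInput_compareRuns accP accQ) _ _ (by omega) _) _ _ (by omega) _⟩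
  refine ⟨(by decide : (2 : ℕ) ≠ 0), loopsOverInput_repeatPow h c, ?_⟩
  simp [decision, Program.LoopsOverInput]

/-! ### Randomizing the qubits -/

theorem sum_sum_update {n : ℕ} (i : Fin n) (g : Bits n → ℝ) :
    ∑ x, ∑ o, g (update x i o) = 2 * ∑ x, g x := by
  let e : Bits n ≃ Bits n := Function.Involutive.toPerm
    (fun x => update x i (!(x i))) (fun x => by simp)
  have h : ∀ x, ∑ o, g (update x i o) = g x + g (e x) := by
    intro x
    have h1 : g (e x) = g (update x i (!(x i))) := rfl
    have h2 : g x = g (update x i (x i)) := by rw [Function.update_eq_self]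
    rw [h1, h2, Fintype.sum_bool]
    cases x i
    · simp [add_comm]
    · simp
  simp only [h, Finset.sum_add_distrib, Equiv.sum_comp e g]
  ring

/-- Summation over one bit is self-adjoint; this moves the randomization of a qubit from the state
to the continuation. -/
theorem sum_update_mul {n : ℕ} (i : Fin n) (a t : Bits n → ℝ) :
    ∑ x, (∑ o, a (update x i o)) * t x = ∑ x, a x * ∑ o, t (update x i o) := by
  have h1 := sum_sum_update i fun x => (∑ o, a (update x i o)) * t x
  have h2 := sum_sum_update i fun x => a x * ∑ o, t (update x i o)
  simp only [Function.update_idem] at h1 h2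
  have h3 : ∑ x, ∑ o, (∑ o', a (update x i o')) * t (update x i o) =
      ∑ x, ∑ o, a (update x i o) * ∑ o', t (update x i o') := by
    refine Finset.sum_congr rfl fun x _ => ?_
    rw [← Finset.mul_sum, ← Finset.sum_mul]
  linarith

/-- The mean of `t` over all values of the bits from position `q` on. -/
noncomputable def tailMean {n : ℕ} (q : ℕ) (t : Bits n → ℝ) (x : Bits n) : ℝ :=
  (∑ y : Bits n, t fun j => if (j : ℕ) < q then x j else y j) / 2 ^ n

theorem tailMean_zero {n : ℕ} (t : Bits n → ℝ) (x : Bits n) :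
    tailMean 0 t x = (∑ y, t y) / 2 ^ n := by
  simp [tailMean]

theorem tailMean_self {n : ℕ} (t : Bits n → ℝ) (x : Bits n) : tailMean n t x = t x := by
  simp [tailMean]

theorem tailMean_succ {n : ℕ} (i : Fin n) (t : Bits n → ℝ) (x : Bits n) :
    (∑ o, tailMean (i + 1) t (update x i o)) / 2 = tailMean i t x := by
  have h : ∀ (o : Bool) (y : Bits n),
      (fun j : Fin n => if (j : ℕ) < i + 1 then update x i o j else y j) =
        fun j : Fin n => if (j : ℕ) < i then x j else update y i o j := by
    intro o y
    funext j
    by_cases hj : j = i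
    · subst hj; simp
    · have : (j : ℕ) ≠ i := fun h => hj (Fin.ext h)
      have h2 : (j : ℕ) < i + 1 ↔ (j : ℕ) < i := by omega
      simp [hj, h2]
  unfold tailMean
  simp only [h]
  rw [← Finset.sum_div, Finset.sum_comm,
    sum_sum_update i fun y => t fun j : Fin n => if (j : ℕ) < i then x j else y j]
  ring

/-- The relevant part of the register contents. -/
def tally (ρ : ℕ → ℕ) : ℕ × ℕ × ℕ := (ρ 5, ρ 6, ρ 7)

/-- The registers below `r` other than the work registers `3, …, 8` agree. -/
def Agree (r : ℕ) (ρ₀ ρ : ℕ → ℕ) : Prop := ∀ i < r, i < 3 ∨ 8 < i → ρ i = ρ₀ i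

theorem Agree.update {r : ℕ} {ρ₀ ρ : ℕ → ℕ} (h : Agree r ρ₀ ρ) {i : ℕ}
    (hi : 3 ≤ i ∧ i ≤ 8) (v : ℕ) : Agree r ρ₀ (update ρ i v) := by
  intro j hj hj'
  rw [Function.update_of_ne (by omega)]
  exact h j hj hj'

theorem qubitAt_of_lt {n q : ℕ} (h : q < n) : qubitAt n q = some ⟨q, h⟩ := dif_pos h

theorem norm_hadamard_sq (b c : Bool) : ‖Gate.mat .H b c‖ ^ 2 = 1 / 2 := by
  simp only [Gate.mat, Matrix.of_apply, norm_div, Complex.norm_real, Real.norm_eq_abs, div_pow,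
    sq_abs, Real.sq_sqrt (show (0 : ℝ) ≤ 2 by norm_num)]
  split <;> simp

theorem qubitProject_hadamard {n : ℕ} (i : Fin n) (o o' : Bool) (φ : Bits n → ℂ) (x : Bits n) :
    qubitProject i o' (qubitGate (Gate.mat .H) i (qubitProject i o φ)) x =
      if x i = o' then Gate.mat .H o' o * φ (update x i o) else 0 := by
  simp only [qubitProject, qubitGate, Fintype.sum_bool, Function.update_self]
  split
  · next h => cases o <;> simp [h]
  · rfl

/-- Measuring, applying a Hadamard gate and measuring again leaves a uniform bit whatever the state
was, so the leftover state of an earlier run does no harm. All qubits end up measured, so the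
continuation matters only on multiples of basis vectors. -/
theorem sem_seq_randomize {n : ℕ} (U : Operator n) {r : ℕ} {ρ₀ : ℕ → ℕ} (hr : 10 ≤ r)
    (hn : ρ₀ 0 = n) (h2 : ρ₀ 2 = 1) (K : Program) (F : Observable n)
    (k : Bits n → ℕ → ℕ × ℕ × ℕ → ℝ)
    (hK : ∀ ρ s c, Agree r ρ₀ ρ → ρ 4 ≤ 1 →
      K.sem U F ρ (Pi.single s c) = ‖c‖ ^ 2 * k s (ρ 4) (tally ρ))
    (ρ : ℕ → ℕ) (φ : Bits n → ℂ) (hρ : Agree r ρ₀ ρ) (h4 : ρ 4 ≤ 1) :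
    (Program.seq randomize K).sem U F ρ φ =
      normSq φ * ((∑ s, k s (ρ 4) (tally ρ)) / 2 ^ n) := by
  set body : Program := .seq (.measure 8 3) (.seq (.gate .H 8) (.seq (.measure 8 3) (.add 8 8 2)))
    with hbody
  -- Invariant with `q` qubits done and `m` to go: the first `q` bits are constant on the support,
  -- and the bits from `q` on will be averaged.
  have key : ∀ m q, q + m = n → ∀ ρ φ, Agree r ρ₀ ρ → ρ 4 ≤ 1 → ρ 8 = q →
      (∃ x₀ : Bits n, ∀ x, φ x ≠ 0 → ∀ i : Fin n, (i : ℕ) < q → x i = x₀ i) →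
      (body.sem U)^[m] (K.sem U F) ρ φ =
        ∑ x, ‖φ x‖ ^ 2 * tailMean q (fun s => k s (ρ 4) (tally ρ)) x := by
    intro m
    induction m with
    | zero =>
      intro q hq ρ φ hρ h4 h8 hφ
      obtain rfl : q = n := by omega
      obtain ⟨x₀, hx₀⟩ := hφ
      have hs : φ = Pi.single x₀ (φ x₀) := by
        funext x
        by_cases hx : x = x₀
        · subst hx; simp
        · rw [Pi.single_eq_of_ne hx]
          by_contra h
          exact hx (funext fun i => hx₀ x h i i.2)
      rw [Function.iterate_zero, id_eq]
      conv_lhs => rw [hs]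
      rw [hK _ _ _ hρ h4, Finset.sum_eq_single x₀, tailMean_self]
      · intro x _ hx
        rw [hs, Pi.single_eq_of_ne hx]
        simp
      · simp
    | succ m ih =>
      intro q hq ρ φ hρ h4 h8 hφ
      have hqn : q < n := by omega
      set i : Fin n := ⟨q, hqn⟩ with hi
      rw [Function.iterate_succ_apply']
      have hρ2 : ρ 2 = 1 := (hρ 2 (by omega) (by omega)).trans h2
      -- The first outcome `o` is forgotten and `o'` is the new bit; the factor 1/2 is the squared
      -- modulus of a Hadamard entry.
      have hout : ∀ (a b : ℕ) (o o' : Bool),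
          (body.sem U)^[m] (K.sem U F) (update (update (update ρ 3 a) 3 b) 8 (q + 1))
            (qubitProject i o' (qubitGate (Gate.mat .H) i (qubitProject i o φ))) =
          ∑ x, (if x i = o' then 1 / 2 * ‖φ (update x i o)‖ ^ 2 else 0) *
            tailMean (q + 1) (fun s => k s (ρ 4) (tally ρ)) x := by
        intro a b o o'
        rw [ih (q + 1) (by omega) _ _ (((hρ.update (by omega) _).update (by omega) _).update
          (by omega) _) (by simpa using h4) (by simp)]
        · refine Finset.sum_congr rfl fun x _ => ?_
          congr 1
          rw [qubitProject_hadamard]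
          by_cases hx : x i = o'
          · rw [if_pos hx, if_pos hx, norm_mul, mul_pow, norm_hadamard_sq]
          · rw [if_neg hx, if_neg hx]
            simp
        · obtain ⟨x₀, hx₀⟩ := hφ
          refine ⟨update x₀ i o', fun x hx j hj => ?_⟩
          rw [qubitProject_hadamard] at hx
          by_cases hji : j = i
          · subst hji
            by_contra h
            apply hx
            rw [Function.update_self] at h
            simp [h]
          · have hjq : (j : ℕ) < q := by
              have : (j : ℕ) ≠ q := fun h => hji (Fin.ext h)
              omega
            have hx' : φ (update x i o) ≠ 0 := by
              intro h
              apply hx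
              simp [h]
            have := hx₀ _ hx' j hjq
            rw [Function.update_of_ne hji] at this
            rw [Function.update_of_ne hji, this]
      have hbodysem : ∀ E : Observable n, body.sem U E ρ φ =
          ∑ o : Bool, ∑ o' : Bool, E (update (update (update ρ 3 o.toNat) 3 o'.toNat) 8 (q + 1))
            (qubitProject i o' (qubitGate (Gate.mat .H) i (qubitProject i o φ))) := by
        intro E
        simp [hbody, Program.sem, h8, qubitAt_of_lt hqn, hρ2, ← hi]
        ring
      rw [hbodysem]
      simp only [hout]
      have hsum : ∀ t : Bits n → ℝ,
          ∑ o : Bool, ∑ o' : Bool, ∑ x : Bits n,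
            (if x i = o' then 1 / 2 * ‖φ (update x i o)‖ ^ 2 else 0) * t x =
          ∑ x, (∑ o, 1 / 2 * ‖φ (update x i o)‖ ^ 2) * t x := by
        intro t
        simp only [Fintype.sum_bool, ← Finset.sum_add_distrib]
        refine Finset.sum_congr rfl fun x _ => ?_
        cases x i <;> simp <;> ring
      rw [hsum, sum_update_mul i fun x => 1 / 2 * ‖φ x‖ ^ 2]
      refine Finset.sum_congr rfl fun x _ => ?_
      rw [← show tailMean (i : ℕ) _ x = tailMean q _ x from rfl, ← tailMean_succ i]
      ring
  have hn' : ρ 0 = n := (hρ 0 (by omega) (by omega)).trans hn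
  have h := key n 0 (by omega) (update ρ 8 0) φ (hρ.update (by omega) _) (by simpa using h4)
    (by simp) ⟨fun _ => false, by simp⟩
  simp only [tailMean_zero, ← Finset.sum_mul] at h
  simpa [Program.sem, randomize, ← hbody, hn', normSq, tally] using h

/-! ### Measuring parities -/

/-- The bit at a position, which is `false` outside the register. -/
def bitAt {n : ℕ} (x : Bits n) (q : ℕ) : Bool := if h : q < n then x ⟨q, h⟩ else false

/-- The parity of the bits at the positions of the tensor factors. -/
def parity {n : ℕ} (ρ : ℕ → ℕ) (acc : List (ℕ × Pauli)) (x : Bits n) : Bool :=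
  acc.foldr (fun s b => xor (bitAt x (ρ s.1)) b) false

/-- Flip a bit, represented as a number, if `o` holds. -/
def flipIf (o : Bool) (b : ℕ) : ℕ := if o then 1 - b else b

theorem flipIf_flipIf (o o' : Bool) {b : ℕ} (hb : b ≤ 1) :
    flipIf o (flipIf o' b) = flipIf (xor o' o) b := by
  cases o <;> cases o' <;> simp [flipIf]
  omega

theorem sem_flipBy {n : ℕ} (U : Operator n) (q : ℕ) (E : Observable n) (ρ : ℕ → ℕ)
    (φ : Bits n → ℂ) (hρ2 : ρ 2 = 1) :
    (flipBy q).sem U E ρ φ =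
      match qubitAt n (ρ q) with
      | some i => E (update ρ 3 0) (qubitProject i false φ) +
          E (update (update ρ 3 1) 4 (1 - ρ 4)) (qubitProject i true φ)
      | none => E (update ρ 3 0) φ := by
  simp only [flipBy, Program.sem]
  cases qubitAt n (ρ q) <;> simp [hρ2]

/-- The continuation depends on the state through the |φ x|² only, so each basis label contributes
separately with its own parity. -/
theorem sem_flips {n : ℕ} (U : Operator n) {r : ℕ} {ρ₀ : ℕ → ℕ} (hr : 10 ≤ r) (h2 : ρ₀ 2 = 1)
    (K : Program) (F : Observable n) (k : Bits n → ℕ → ℕ × ℕ × ℕ → ℝ)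
    (hK : ∀ ρ φ, Agree r ρ₀ ρ → ρ 4 ≤ 1 →
      K.sem U F ρ φ = ∑ x, ‖φ x‖ ^ 2 * k x (ρ 4) (tally ρ))
    (acc : List (ℕ × Pauli)) (hacc : ∀ s ∈ acc, 10 ≤ s.1 ∧ s.1 < r)
    (ρ : ℕ → ℕ) (φ : Bits n → ℂ) (hρ : Agree r ρ₀ ρ) (h4 : ρ 4 ≤ 1) :
    (flips acc K).sem U F ρ φ =
      ∑ x, ‖φ x‖ ^ 2 * k x (flipIf (parity ρ₀ acc x) (ρ 4)) (tally ρ) := by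
  induction acc generalizing ρ φ with
  | nil => simpa [flips, parity, flipIf] using hK ρ φ hρ h4
  | cons s acc ih =>
    have ih' := ih fun s hs => hacc s (List.mem_cons_of_mem _ hs)
    have hρ2 : ρ 2 = 1 := (hρ 2 (by omega) (by omega)).trans h2
    have hs := hacc s List.mem_cons_self
    have hρs : ρ s.1 = ρ₀ s.1 := hρ _ hs.2 (by omega)
    have hpar : ∀ x : Bits n, flipIf (parity ρ₀ (s :: acc) x) (ρ 4) =
        flipIf (parity ρ₀ acc x) (flipIf (bitAt x (ρ s.1)) (ρ 4)) := by
      intro x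
      rw [flipIf_flipIf _ _ h4, hρs]
      rfl
    simp only [hpar]
    rw [show (flips (s :: acc) K).sem U F ρ φ = (flipBy s.1).sem U ((flips acc K).sem U F) ρ φ
      from rfl, sem_flipBy U _ _ _ _ hρ2]
    by_cases hq : ρ s.1 < n
    · rw [qubitAt_of_lt hq]
      simp only
      rw [ih' _ _ (hρ.update (by omega) _) (by simpa using h4),
        ih' _ _ ((hρ.update (by omega) _).update (by omega) _) (by simp), ← Finset.sum_add_distrib]
      refine Finset.sum_congr rfl fun x _ => ?_
      simp only [bitAt, dif_pos hq, qubitProject]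
      cases x ⟨ρ s.1, hq⟩ <;> simp [flipIf, tally]
    · rw [qubitAt, dif_neg hq]
      simp only
      rw [ih' _ _ (hρ.update (by omega) _) (by simpa using h4)]
      simp [bitAt, hq, flipIf, tally]

theorem qubitProject_single {n : ℕ} (i : Fin n) (o : Bool) (s : Bits n) (c : ℂ) :
    qubitProject i o (Pi.single s c) = if s i = o then Pi.single s c else 0 := by
  funext x
  by_cases hx : x = s
  · subst hx
    by_cases h : x i = o <;> simp [qubitProject, h]
  · by_cases h : s i = o <;> simp [qubitProject, h, hx]

/-- On a basis vector the outcome is certain and the state survives; the other outcome gives the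
zero vector, where `k` must therefore vanish. The continuation may depend on amplitudes, since gates
and a query still follow. -/
theorem sem_flips_single {n : ℕ} (U : Operator n) {r : ℕ} {ρ₀ : ℕ → ℕ} (hr : 10 ≤ r)
    (h2 : ρ₀ 2 = 1) (K : Program) (F : Observable n)
    (k : (Bits n → ℂ) → ℕ → ℕ × ℕ × ℕ → ℝ) (hk : ∀ b v, k 0 b v = 0)
    (hK : ∀ ρ φ, Agree r ρ₀ ρ → ρ 4 ≤ 1 → K.sem U F ρ φ = k φ (ρ 4) (tally ρ))
    (acc : List (ℕ × Pauli)) (hacc : ∀ s ∈ acc, 10 ≤ s.1 ∧ s.1 < r)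
    (ρ : ℕ → ℕ) (s : Bits n) (c : ℂ) (hρ : Agree r ρ₀ ρ) (h4 : ρ 4 ≤ 1) :
    (flips acc K).sem U F ρ (Pi.single s c) =
      k (Pi.single s c) (flipIf (parity ρ₀ acc s) (ρ 4)) (tally ρ) := by
  induction acc generalizing ρ c with
  | nil => simpa [flips, parity, flipIf] using hK ρ (Pi.single s c) hρ h4
  | cons a acc ih =>
    have ih' := ih fun s hs => hacc s (List.mem_cons_of_mem _ hs)
    have ih0 : ∀ ρ, Agree r ρ₀ ρ → ρ 4 ≤ 1 → (flips acc K).sem U F ρ 0 = 0 := by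
      intro ρ hρ h4
      have := ih' ρ 0 hρ h4
      rwa [Pi.single_zero, hk] at this
    have hρ2 : ρ 2 = 1 := (hρ 2 (by omega) (by omega)).trans h2
    have hs := hacc a List.mem_cons_self
    have hρs : ρ a.1 = ρ₀ a.1 := hρ _ hs.2 (by omega)
    have hpar : flipIf (parity ρ₀ (a :: acc) s) (ρ 4) =
        flipIf (parity ρ₀ acc s) (flipIf (bitAt s (ρ a.1)) (ρ 4)) := by
      rw [flipIf_flipIf _ _ h4, hρs]
      rfl
    rw [hpar, show (flips (a :: acc) K).sem U F ρ (Pi.single s c) =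
      (flipBy a.1).sem U ((flips acc K).sem U F) ρ (Pi.single s c) from rfl,
      sem_flipBy U _ _ _ _ hρ2]
    have hρ3 := fun v => hρ.update (i := 3) (by omega) v
    by_cases hq : ρ a.1 < n
    · rw [qubitAt_of_lt hq]
      simp only [qubitProject_single, bitAt, dif_pos hq]
      cases s ⟨ρ a.1, hq⟩
      · rw [if_pos rfl, if_neg (by decide), ih' _ _ (hρ3 _) (by simpa using h4),
          ih0 _ ((hρ3 _).update (by omega) _) (by simp)]
        simp [flipIf, tally]
      · rw [if_neg (by decide), if_pos rfl, ih' _ _ ((hρ3 _).update (by omega) _) (by simp),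
          ih0 _ (hρ3 _) (by simpa using h4)]
        simp [flipIf, tally]
    · rw [qubitAt, dif_neg hq]
      simp only
      rw [ih' _ _ (hρ3 _) (by simpa using h4)]
      simp [bitAt, hq, flipIf, tally]

/-! ### Basis changes -/

/-- The matrix of a sequence of single-qubit gates. -/
noncomputable def gateMat (gs : List Gate) : Matrix Bool Bool ℂ :=
  gs.foldr (fun g M => M * g.mat) 1

/-- A single-qubit operator at a position, which is void outside the register. -/
def slotMat (n q : ℕ) (M : Matrix Bool Bool ℂ) : Operator n :=
  match qubitAt n q with
  | some i => tens (update (fun _ => 1) i M)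
  | none => 1

/-- The operator applied by `slotGates`. -/
noncomputable def slotsMat (n : ℕ) (f : Pauli → List Gate) (ρ : ℕ → ℕ) (acc : List (ℕ × Pauli)) :
    Operator n :=
  acc.foldr (fun s N => N * slotMat n (ρ s.1) (gateMat (f s.2))) 1

/-- The labels of a Pauli string by position. -/
def labels (ρ : ℕ → ℕ) (acc : List (ℕ × Pauli)) : ℕ → Pauli :=
  acc.foldr (fun s f => update f (ρ s.1) s.2) fun _ => .I

/-- The restriction of a family of labels to the qubits. -/
def onQubits (n : ℕ) (f : ℕ → Pauli) : Fin n → Pauli := fun i => f i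

theorem slotMat_mul (n q : ℕ) (M N : Matrix Bool Bool ℂ) :
    slotMat n q M * slotMat n q N = slotMat n q (M * N) := by
  unfold slotMat
  cases qubitAt n q with
  | none => simp
  | some i =>
    simp only [tens_mul]
    congr 1
    funext j
    by_cases hj : j = i
    · subst hj; simp
    · simp [hj]

theorem slotMat_one (n q : ℕ) : slotMat n q 1 = 1 := by
  unfold slotMat
  cases qubitAt n q with
  | none => rfl
  | some i => simp [tens_one]

theorem sem_gateSeq {n : ℕ} (U : Operator n) (gs : List Gate) (q : ℕ) (P : Program)
    (F : Observable n) (ρ : ℕ → ℕ) (φ : Bits n → ℂ) :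
    (gateSeq gs q P).sem U F ρ φ = P.sem U F ρ ((slotMat n (ρ q) (gateMat gs)).mulVec φ) := by
  induction gs generalizing φ with
  | nil => simp [gateSeq, gateMat, slotMat_one]
  | cons g gs ih =>
    have h : gateMat (g :: gs) = gateMat gs * g.mat := rfl
    have h1 : (gateSeq (g :: gs) q P).sem U F ρ φ =
        (gateSeq gs q P).sem U F ρ ((slotMat n (ρ q) g.mat).mulVec φ) := by
      simp only [gateSeq, List.foldr_cons, Program.sem, slotMat]
      cases qubitAt n (ρ q) <;> simp [tens_update_mulVec]
    rw [h1, ih, Matrix.mulVec_mulVec, slotMat_mul, h]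

theorem sem_slotGates {n : ℕ} (U : Operator n) (f : Pauli → List Gate) (acc : List (ℕ × Pauli))
    (P : Program) (F : Observable n) (ρ : ℕ → ℕ) (φ : Bits n → ℂ) :
    (slotGates f acc P).sem U F ρ φ = P.sem U F ρ ((slotsMat n f ρ acc).mulVec φ) := by
  induction acc generalizing φ with
  | nil => simp [slotGates, slotsMat]
  | cons s acc ih =>
    rw [show slotGates f (s :: acc) P = gateSeq (f s.2) s.1 (slotGates f acc P) from rfl,
      sem_gateSeq, ih, Matrix.mulVec_mulVec]
    rfl

theorem slotsMat_congr {n : ℕ} (f : Pauli → List Gate) {ρ ρ' : ℕ → ℕ} {acc : List (ℕ × Pauli)}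
    (h : ∀ s ∈ acc, ρ s.1 = ρ' s.1) : slotsMat n f ρ acc = slotsMat n f ρ' acc := by
  induction acc with
  | nil => rfl
  | cons s acc ih =>
    have := ih fun s hs => h s (List.mem_cons_of_mem _ hs)
    simp only [slotsMat, List.foldr_cons] at this ⊢
    rw [this, h s List.mem_cons_self]

theorem labels_congr {ρ ρ' : ℕ → ℕ} {acc : List (ℕ × Pauli)}
    (h : ∀ s ∈ acc, ρ s.1 = ρ' s.1) : labels ρ acc = labels ρ' acc := by
  induction acc with
  | nil => rfl
  | cons s acc ih =>
    have := ih fun s hs => h s (List.mem_cons_of_mem _ hs)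
    simp only [labels, List.foldr_cons] at this ⊢
    rw [this, h s List.mem_cons_self]

theorem labels_of_notMem {ρ : ℕ → ℕ} {acc : List (ℕ × Pauli)} {q : ℕ}
    (hq : q ∉ acc.map fun s => ρ s.1) : labels ρ acc q = .I := by
  induction acc with
  | nil => rfl
  | cons s acc ih =>
    simp only [List.map_cons, List.mem_cons, not_or] at hq
    rw [show labels ρ (s :: acc) = update (labels ρ acc) (ρ s.1) s.2 from rfl,
      Function.update_of_ne hq.1]
    exact ih hq.2

/-- The position is new, so its old factor is `g .I = 1` and updating it amounts to multiplication.
A position outside the register changes neither side. -/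
theorem tens_labels_cons {n : ℕ} (g : Pauli → Matrix Bool Bool ℂ) (hg : g .I = 1) (ρ : ℕ → ℕ)
    (s : ℕ × Pauli) (acc : List (ℕ × Pauli)) (hs : ρ s.1 ∉ acc.map fun s => ρ s.1) :
    (tens fun i : Fin n => g (labels ρ (s :: acc) i)) =
      (tens fun i : Fin n => g (labels ρ acc i)) * slotMat n (ρ s.1) (g s.2) := by
  have hI := labels_of_notMem hs
  have hcons : labels ρ (s :: acc) = update (labels ρ acc) (ρ s.1) s.2 := rfl
  unfold slotMat qubitAt
  by_cases hq : ρ s.1 < n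
  · simp only [dif_pos hq, tens_mul]
    congr 1
    funext j
    by_cases hj : j = ⟨ρ s.1, hq⟩
    · subst hj
      simp [hcons, hI, hg]
    · have : (j : ℕ) ≠ ρ s.1 := fun h => hj (Fin.ext h)
      simp [hcons, hj, this]
  · simp only [dif_neg hq, Matrix.mul_one]
    congr 1
    funext j
    have : (j : ℕ) ≠ ρ s.1 := fun h => hq (h ▸ j.2)
    simp [hcons, this]

theorem slotsMat_eq_tens {n : ℕ} (f : Pauli → List Gate) (hf : f .I = []) (ρ : ℕ → ℕ)
    (acc : List (ℕ × Pauli)) (hacc : (acc.map fun s => ρ s.1).Nodup) :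
    slotsMat n f ρ acc = tens fun i : Fin n => gateMat (f (labels ρ acc i)) := by
  induction acc with
  | nil =>
    simp only [slotsMat, labels, List.foldr_nil, hf]
    exact tens_one.symm
  | cons s acc ih =>
    rw [List.map_cons, List.nodup_cons] at hacc
    rw [tens_labels_cons (fun p => gateMat (f p)) (by rw [hf]; rfl) ρ s acc hacc.1, ← ih hacc.2]
    rfl

/-- The sign belonging to a bit. -/
def bitSign (o : Bool) : ℝ := if o then -1 else 1

theorem bitSign_xor (o o' : Bool) : bitSign (xor o o') = bitSign o * bitSign o' := by
  cases o <;> cases o' <;> simp [bitSign]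

/-- The operator into which a Pauli operator is transformed by the change of basis. -/
def Pauli.diag (p : Pauli) : Matrix Bool Bool ℂ := if p = .I then 1 else Pauli.Z.mat

theorem slotMat_Z (n q : ℕ) :
    slotMat n q Pauli.Z.mat = Matrix.diagonal fun x => (bitSign (bitAt x q) : ℂ) := by
  unfold slotMat qubitAt bitAt
  by_cases hq : q < n
  · simp only [dif_pos hq]
    ext x y
    rw [tens_apply]
    by_cases hxy : x = y
    · subst hxy
      rw [Matrix.diagonal_apply_eq, Finset.prod_eq_single ⟨q, hq⟩]
      · cases h : x ⟨q, hq⟩ <;> simp [Pauli.mat, bitSign]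
      · intro j _ hj
        simp [hj]
      · simp
    · rw [Matrix.diagonal_apply_ne _ hxy]
      obtain ⟨j, hj⟩ := Function.ne_iff.mp hxy
      refine Finset.prod_eq_zero (Finset.mem_univ j) ?_
      by_cases hjq : j = ⟨q, hq⟩
      · subst hjq
        simp [Pauli.mat, hj]
      · simp [hjq, hj]
  · simp [hq, bitSign]

theorem tens_diag {n : ℕ} (ρ : ℕ → ℕ) (acc : List (ℕ × Pauli))
    (hacc : (acc.map fun s => ρ s.1).Nodup) (hI : ∀ s ∈ acc, s.2 ≠ .I) :
    (tens fun i : Fin n => (labels ρ acc i).diag) =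
      Matrix.diagonal fun x => (bitSign (parity ρ acc x) : ℂ) := by
  induction acc with
  | nil =>
    simp only [labels, parity, List.foldr_nil, Pauli.diag, if_true, tens_one, bitSign]
    simp
  | cons s acc ih =>
    rw [List.map_cons, List.nodup_cons] at hacc
    rw [tens_labels_cons Pauli.diag rfl ρ s acc hacc.1,
      ih hacc.2 fun s hs => hI s (List.mem_cons_of_mem _ hs), Pauli.diag,
      if_neg (hI s List.mem_cons_self), slotMat_Z, Matrix.diagonal_mul_diagonal]
    congr 1
    funext x
    rw [show parity ρ (s :: acc) x = xor (bitAt x (ρ s.1)) (parity ρ acc x) from rfl, bitSign_xor]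
    push_cast
    ring

/-! ### Identities of the Hadamard and phase gates -/

theorem sqrt_two_mul_self : (Real.sqrt 2 : ℂ) * (Real.sqrt 2 : ℂ) = 2 := by
  rw [← Complex.ofReal_mul, Real.mul_self_sqrt (by norm_num)]
  norm_num

theorem hadamard_mul_self : Gate.H.mat * Gate.H.mat = 1 := by
  have h : (Real.sqrt 2 : ℂ)⁻¹ * (Real.sqrt 2 : ℂ)⁻¹ = 2⁻¹ := by rw [← mul_inv, sqrt_two_mul_self]
  ext a b
  cases a <;> cases b <;> simp [Gate.mat, Matrix.mul_apply, div_eq_mul_inv, h] <;> norm_num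

theorem hadamard_conjTranspose : Gate.H.mat.conjTranspose = Gate.H.mat := by
  ext a b
  cases a <;> cases b <;> simp [Gate.mat, Matrix.conjTranspose_apply]

theorem hadamard_conj_Z : Gate.H.mat * Pauli.Z.mat * Gate.H.mat = Pauli.X.mat := by
  have h : (Real.sqrt 2 : ℂ)⁻¹ * (Real.sqrt 2 : ℂ)⁻¹ = 2⁻¹ := by rw [← mul_inv, sqrt_two_mul_self]
  ext a b
  cases a <;> cases b <;>
    simp [Gate.mat, Pauli.mat, Matrix.mul_apply, div_eq_mul_inv, h] <;> norm_num

theorem phase_mem_unitaryGroup : Gate.S.mat ∈ Matrix.unitaryGroup Bool ℂ := by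
  rw [Matrix.mem_unitaryGroup_iff]
  ext a b
  cases a <;> cases b <;> simp [Gate.mat, Matrix.mul_apply, Matrix.star_apply]

theorem phase_conj_X : Gate.S.mat * Pauli.X.mat * Gate.S.mat.conjTranspose = Pauli.Y.mat := by
  ext a b
  cases a <;> cases b <;> simp [Gate.mat, Pauli.mat, Matrix.mul_apply, Matrix.conjTranspose_apply]

theorem phase_pow_three : Gate.S.mat * Gate.S.mat * Gate.S.mat = Gate.S.mat.conjTranspose := by
  ext a b
  cases a <;> cases b <;> simp [Gate.mat, Matrix.mul_apply, Matrix.conjTranspose_apply]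

/-- The adjoint of S is S³, so the inverse change of basis is available from the gate set. -/
theorem gateMat_rot (p : Pauli) : gateMat p.rot = (gateMat p.prep).conjTranspose := by
  cases p
  · simp [gateMat, Pauli.rot, Pauli.prep]
  · simp [gateMat, Pauli.rot, Pauli.prep, hadamard_conjTranspose]
  · simp only [gateMat, Pauli.rot, Pauli.prep, List.foldr_cons, List.foldr_nil, Matrix.one_mul,
      Matrix.conjTranspose_mul, hadamard_conjTranspose]
    rw [← phase_pow_three]
    simp only [Matrix.mul_assoc]
  · simp [gateMat, Pauli.rot, Pauli.prep]

theorem gateMat_prep_mem (p : Pauli) : gateMat p.prep ∈ Matrix.unitaryGroup Bool ℂ := by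
  have hH : Gate.H.mat ∈ Matrix.unitaryGroup Bool ℂ := by
    rw [Matrix.mem_unitaryGroup_iff, Matrix.star_eq_conjTranspose, hadamard_conjTranspose,
      hadamard_mul_self]
  cases p
  · exact one_mem _
  · simpa [gateMat, Pauli.prep] using hH
  · simpa [gateMat, Pauli.prep] using mul_mem phase_mem_unitaryGroup hH
  · exact one_mem _

theorem gateMat_conj_diag (p : Pauli) :
    gateMat p.prep * p.diag * (gateMat p.prep).conjTranspose = p.mat := by
  cases p
  · simp [gateMat, Pauli.prep, Pauli.diag, Pauli.mat]
  · simp [gateMat, Pauli.prep, Pauli.diag, hadamard_conjTranspose, hadamard_conj_Z]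
  · simp only [gateMat, Pauli.prep, Pauli.diag, List.foldr_cons, List.foldr_nil, Matrix.one_mul,
      Matrix.conjTranspose_mul, hadamard_conjTranspose]
    rw [if_neg (by decide), ← phase_conj_X, ← hadamard_conj_Z]
    simp only [Matrix.mul_assoc]
  · simp [gateMat, Pauli.prep, Pauli.diag]

/-- The change of basis for a Pauli string. -/
noncomputable def basisChange {n : ℕ} (l : Fin n → Pauli) : Operator n :=
  tens fun i => gateMat (l i).prep

theorem basisChange_mem {n : ℕ} (l : Fin n → Pauli) :
    basisChange l ∈ Matrix.unitaryGroup (Bits n) ℂ :=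
  tens_mem_unitaryGroup fun i => gateMat_prep_mem (l i)

theorem pauliOp_eq {n : ℕ} (l : Fin n → Pauli) :
    pauliOp l = basisChange l * (tens fun i => (l i).diag) * (basisChange l).conjTranspose := by
  simp only [basisChange, tens_conjTranspose, tens_mul, gateMat_conj_diag, pauliOp]

theorem trace_diagonal_conj {n : ℕ} (a b : Bits n → ℝ) (W : Operator n) :
    (Matrix.diagonal (fun x => (a x : ℂ)) * (W * Matrix.diagonal (fun x => (b x : ℂ)) *
      W.conjTranspose)).trace = ((∑ s, ∑ x, ‖W x s‖ ^ 2 * (a x * b s) : ℝ) : ℂ) := by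
  simp only [Matrix.trace, Matrix.diag, Matrix.diagonal_mul]
  rw [Finset.sum_comm]
  push_cast
  refine Finset.sum_congr rfl fun x _ => ?_
  rw [Matrix.mul_apply, Finset.mul_sum]
  refine Finset.sum_congr rfl fun s _ => ?_
  rw [Matrix.mul_diagonal, Matrix.conjTranspose_apply]
  have : W x s * star (W x s) = (‖W x s‖ : ℂ) ^ 2 := Complex.mul_conj' _
  rw [← this]
  ring

/-! ### A single run -/

/-- The first admissible position of the next tensor factor. -/
def nextPos (ρ : ℕ → ℕ) : List (ℕ × Pauli) → ℕ
  | [] => 0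
  | s :: _ => ρ s.1 + 1

/-- The list `acc` describes a Pauli string with registers below `r` and increasing positions. -/
structure SlotsOK (r : ℕ) (ρ : ℕ → ℕ) (acc : List (ℕ × Pauli)) : Prop where
  reg : ∀ s ∈ acc, 10 ≤ s.1 ∧ s.1 < r
  label : ∀ s ∈ acc, s.2 ≠ .I
  lt : ∀ s ∈ acc, ρ s.1 < nextPos ρ acc
  nodup : (acc.map fun s => ρ s.1).Nodup

/-- The operator between preparation and measurement in a run. -/
noncomputable def runOp {n : ℕ} (U : Operator n) (ρ : ℕ → ℕ) (accP accQ : List (ℕ × Pauli)) :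
    Operator n :=
  slotsMat n Pauli.rot ρ accP * (U * slotsMat n Pauli.prep ρ accQ)

theorem runOp_eq {n : ℕ} (U : Operator n) {r : ℕ} {ρ : ℕ → ℕ} {accP accQ : List (ℕ × Pauli)}
    (hP : SlotsOK r ρ accP) (hQ : SlotsOK r ρ accQ) :
    runOp U ρ accP accQ = (basisChange (onQubits n (labels ρ accP))).conjTranspose *
      (U * basisChange (onQubits n (labels ρ accQ))) := by
  rw [runOp, slotsMat_eq_tens _ rfl _ _ hP.nodup, slotsMat_eq_tens _ rfl _ _ hQ.nodup]
  simp only [basisChange, tens_conjTranspose, ← gateMat_rot, onQubits]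

/-- Both strings are diagonalized and the changes of basis absorbed into `runOp`. The trace becomes
the mean product of two signs, with uniform input `s` and outcome `x` distributed by the Born rule.
-/
theorem corr_eq_sum {n : ℕ} (U : Operator n) {r : ℕ} {ρ : ℕ → ℕ} {accP accQ : List (ℕ × Pauli)}
    (hP : SlotsOK r ρ accP) (hQ : SlotsOK r ρ accQ) :
    corr U (onQubits n (labels ρ accP)) (onQubits n (labels ρ accQ)) =
      (∑ s, ∑ x, ‖runOp U ρ accP accQ x s‖ ^ 2 *
        (bitSign (parity ρ accP x) * bitSign (parity ρ accQ s))) / 2 ^ n := by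
  have h := trace_diagonal_conj (n := n) (fun x => bitSign (parity ρ accP x))
    (fun x => bitSign (parity ρ accQ x)) (runOp U ρ accP accQ)
  rw [corr]
  congr 1
  rw [← Complex.ofReal_re (∑ s, _), ← h]
  congr 1
  rw [pauliOp_eq (onQubits n (labels ρ accP)), pauliOp_eq (onQubits n (labels ρ accQ)),
    runOp_eq U hP hQ, ← tens_diag ρ accP hP.nodup hP.label, ← tens_diag ρ accQ hQ.nodup hQ.label]
  simp only [onQubits, Matrix.conjTranspose_mul, Matrix.conjTranspose_conjTranspose,
    Matrix.mul_assoc]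
  rw [Matrix.trace_mul_comm]
  simp only [Matrix.mul_assoc]

theorem sum_norm_runOp {n : ℕ} (U : UnitaryOp n) {r : ℕ} {ρ : ℕ → ℕ}
    {accP accQ : List (ℕ × Pauli)} (hP : SlotsOK r ρ accP) (hQ : SlotsOK r ρ accQ) (s : Bits n) :
    ∑ x, ‖runOp (U : Operator n) ρ accP accQ x s‖ ^ 2 = 1 := by
  have hmem : runOp (U : Operator n) ρ accP accQ ∈ Matrix.unitaryGroup (Bits n) ℂ := by
    rw [runOp_eq _ hP hQ]
    exact mul_mem (Unitary.star_mem (basisChange_mem _)) (mul_mem U.2 (basisChange_mem _))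
  have h := congrFun (congrFun (Matrix.mem_unitaryGroup_iff'.mp hmem) s) s
  rw [Matrix.mul_apply, Matrix.one_apply_eq] at h
  have h2 : ∀ x, star (runOp (U : Operator n) ρ accP accQ) s x *
      runOp (U : Operator n) ρ accP accQ x s =
        ((‖runOp (U : Operator n) ρ accP accQ x s‖ ^ 2 : ℝ) : ℂ) := by
    intro x
    push_cast
    exact Complex.conj_mul' _
  simp only [h2, ← Complex.ofReal_sum] at h
  exact_mod_cast h

theorem apply_flipIf (h : ℕ → ℝ) (o : Bool) (b : ℕ) :
    h (flipIf o b) = (1 + bitSign o) / 2 * h b + (1 - bitSign o) / 2 * h (1 - b) := by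
  cases o <;> simp [flipIf, bitSign]

/-- The product of the two eigenvalues of a run is a sign with mean `corr`, so the parity is kept
with probability (1 + corr)/2 and flipped otherwise. -/
theorem sem_singleRun {n : ℕ} (U : UnitaryOp n) {r : ℕ} {ρ₀ : ℕ → ℕ} (hr : 10 ≤ r)
    (hn : ρ₀ 0 = n) (h2 : ρ₀ 2 = 1) {accP accQ : List (ℕ × Pauli)}
    (hP : SlotsOK r ρ₀ accP) (hQ : SlotsOK r ρ₀ accQ) (K : Program) (F : Observable n)
    (k : ℕ → ℕ × ℕ × ℕ → ℝ)
    (hK : ∀ ρ φ, Agree r ρ₀ ρ → ρ 4 ≤ 1 →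
      K.sem (U : Operator n) F ρ φ = normSq φ * k (ρ 4) (tally ρ))
    (ρ : ℕ → ℕ) (φ : Bits n → ℂ) (hρ : Agree r ρ₀ ρ) (h4 : ρ 4 ≤ 1) :
    (singleRun accP accQ K).sem (U : Operator n) F ρ φ = normSq φ *
      ((1 + corr (U : Operator n) (onQubits n (labels ρ₀ accP)) (onQubits n (labels ρ₀ accQ))) / 2 *
          k (ρ 4) (tally ρ) +
        (1 - corr (U : Operator n) (onQubits n (labels ρ₀ accP)) (onQubits n (labels ρ₀ accQ))) / 2 *
          k (1 - ρ 4) (tally ρ)) := by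
  set W := runOp (U : Operator n) ρ₀ accP accQ with hW
  have h1 : ∀ ρ φ, Agree r ρ₀ ρ → ρ 4 ≤ 1 →
      (slotGates Pauli.prep accQ (.seq .query (slotGates Pauli.rot accP (flips accP K)))).sem
        (U : Operator n) F ρ φ =
      ∑ x, ‖W.mulVec φ x‖ ^ 2 * k (flipIf (parity ρ₀ accP x) (ρ 4)) (tally ρ) := by
    intro ρ φ hρ h4
    rw [sem_slotGates]
    simp only [Program.sem]
    rw [sem_slotGates, sem_flips (U : Operator n) hr h2 K F (fun _ => k) ?_ accP hP.reg _ _ hρ h4,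
      Matrix.mulVec_mulVec, Matrix.mulVec_mulVec,
      slotsMat_congr _ fun s hs => hρ s.1 (hP.reg s hs).2 (Or.inr (by have := (hP.reg s hs).1; omega)),
      slotsMat_congr _ fun s hs => hρ s.1 (hQ.reg s hs).2 (Or.inr (by have := (hQ.reg s hs).1; omega)),
      Matrix.mul_assoc]
    · rfl
    · intro ρ φ hρ h4
      rw [hK ρ φ hρ h4, normSq, Finset.sum_mul]
  have h3 := sem_seq_randomize (U : Operator n) hr hn h2
    (flips accQ (slotGates Pauli.prep accQ (.seq .query
      (slotGates Pauli.rot accP (flips accP K))))) F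
    (fun s b v => ∑ x, ‖W x s‖ ^ 2 * k (flipIf (parity ρ₀ accP x) (flipIf (parity ρ₀ accQ s) b)) v)
    ?_ ρ φ hρ h4
  · rw [singleRun, h3]
    congr 1
    -- A function of a sign is affine in it, so only the mean of the sign enters.
    have h5 : ∀ s x : Bits n, k (flipIf (parity ρ₀ accP x) (flipIf (parity ρ₀ accQ s) (ρ 4))) (tally ρ) =
        (k (ρ 4) (tally ρ) + k (1 - ρ 4) (tally ρ)) / 2 +
          bitSign (parity ρ₀ accP x) * bitSign (parity ρ₀ accQ s) *
            ((k (ρ 4) (tally ρ) - k (1 - ρ 4) (tally ρ)) / 2) := by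
      intro s x
      rw [flipIf_flipIf _ _ h4, apply_flipIf fun b => k b (tally ρ), bitSign_xor]
      ring
    -- The constant part uses that the columns of the unitary `W` have norm one.
    have h6 : ∀ c₁ c₂ : ℝ, (∑ s, ∑ x, ‖W x s‖ ^ 2 *
        (c₁ + bitSign (parity ρ₀ accP x) * bitSign (parity ρ₀ accQ s) * c₂)) / 2 ^ n =
        c₁ + corr (U : Operator n) (onQubits n (labels ρ₀ accP)) (onQubits n (labels ρ₀ accQ)) *
          c₂ := by
      intro c₁ c₂
      rw [corr_eq_sum (U : Operator n) hP hQ, ← hW]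
      simp only [mul_add, Finset.sum_add_distrib, ← mul_assoc, ← Finset.sum_mul]
      simp only [hW, sum_norm_runOp U hP hQ]
      simp only [Finset.sum_const, Finset.card_univ, Fintype.card_pi, Fintype.card_bool,
        Finset.prod_const, Fintype.card_fin, nsmul_eq_mul, mul_one]
      push_cast
      field_simp
    simp only [h5, h6]
    ring
  · intro ρ s c hρ h4
    rw [sem_flips_single (U : Operator n) hr h2 _ F
      (fun φ b v => ∑ x, ‖W.mulVec φ x‖ ^ 2 * k (flipIf (parity ρ₀ accP x) b) v) ?_ h1 accQ hQ.reg
      ρ s c hρ h4, Finset.mul_sum]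
    · refine Finset.sum_congr rfl fun x _ => ?_
      rw [Matrix.mulVec_single]
      simp only [Pi.smul_apply, Matrix.col_apply, MulOpposite.smul_eq_mul_unop,
        MulOpposite.unop_op, norm_mul, mul_pow]
      ring
    · simp

/-! ### The whole program -/

/-- The effect of adding an independent sign with mean `m` to the tally on expectations. -/
noncomputable def step (m : ℝ) (g : ℕ × ℕ × ℕ → ℝ) : ℕ × ℕ × ℕ → ℝ :=
  fun v => (1 + m) / 2 * g (v.1 + 1, v.2.1, v.2.2) + (1 - m) / 2 * g (v.1, v.2.1 + 1, v.2.2)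

/-- The effect of adding independent signs with the given means to the tally on expectations. -/
noncomputable def steps (L : List ℝ) (g : ℕ × ℕ × ℕ → ℝ) : ℕ × ℕ × ℕ → ℝ := L.foldr step g

theorem steps_append (L L' : List ℝ) (g : ℕ × ℕ × ℕ → ℝ) :
    steps (L ++ L') g = steps L (steps L' g) := List.foldr_append

/-- The program changes the tally as described by `A` and preserves the registers below `r` other
than the work registers, if their contents are those of `ρ₀`. -/
def Transforms {n : ℕ} (U : Operator n) (r : ℕ) (ρ₀ : ℕ → ℕ) (P : Program)
    (A : (ℕ × ℕ × ℕ → ℝ) → ℕ × ℕ × ℕ → ℝ) : Prop :=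
  ∀ (G : Observable n) (g : ℕ × ℕ × ℕ → ℝ),
    (∀ ρ φ, Agree r ρ₀ ρ → G ρ φ = normSq φ * g (tally ρ)) →
      ∀ ρ φ, Agree r ρ₀ ρ → P.sem U G ρ φ = normSq φ * A g (tally ρ)

/-- Two runs with mean M leave an even parity with probability ((1 + M)² + (1 - M)²)/4 = (1 + M²)/2.
Independence holds because each run starts by randomizing the qubits. -/
theorem transforms_compareRuns {n : ℕ} (U : UnitaryOp n) {r : ℕ} {ρ₀ : ℕ → ℕ} (hr : 10 ≤ r)
    (hn : ρ₀ 0 = n) (h2 : ρ₀ 2 = 1) {accP accQ : List (ℕ × Pauli)}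
    (hP : SlotsOK r ρ₀ accP) (hQ : SlotsOK r ρ₀ accQ) :
    Transforms (U : Operator n) r ρ₀ (compareRuns accP accQ)
      (step (corr (U : Operator n) (onQubits n (labels ρ₀ accP))
        (onQubits n (labels ρ₀ accQ)) ^ 2)) := by
  intro G g hG ρ φ hρ
  set M := corr (U : Operator n) (onQubits n (labels ρ₀ accP)) (onQubits n (labels ρ₀ accQ))
  set k₀ : ℕ → ℕ × ℕ × ℕ → ℝ := fun b v =>
    if b = 0 then g (v.1 + 1, v.2.1, v.2.2) else g (v.1, v.2.1 + 1, v.2.2)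
  have h0 : ∀ ρ φ, Agree r ρ₀ ρ → ρ 4 ≤ 1 →
      (Program.ifZero 4 (.add 5 5 2) (.add 6 6 2)).sem (U : Operator n) G ρ φ =
        normSq φ * k₀ (ρ 4) (tally ρ) := by
    intro ρ φ hρ _
    have hρ2 : ρ 2 = 1 := (hρ 2 (by omega) (by omega)).trans h2
    simp only [Program.sem, hρ2, k₀]
    split
    · rw [hG _ _ (hρ.update (by omega) _)]
      simp [tally]
    · rw [hG _ _ (hρ.update (by omega) _)]
      simp [tally]
  have h1 := sem_singleRun U hr hn h2 hP hQ _ G k₀ h0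
  have h3 := sem_singleRun U hr hn h2 hP hQ _ G
    (fun b v => (1 + M) / 2 * k₀ b v + (1 - M) / 2 * k₀ (1 - b) v) h1 (update ρ 4 0) φ
    (hρ.update (by omega) _) (by simp)
  rw [compareRuns]
  simp only [Program.sem] at h3 ⊢
  rw [h3]
  congr 1
  simp only [k₀, step, Function.update_self, tally]
  simp
  ring

/-! ### Enumeration of Pauli strings -/

/-- The Pauli strings with at most `m` further tensor factors, at increasing positions from `start`
on, as listed by `nest`. -/
def strings (n : ℕ) : ℕ → ℕ → (ℕ → Pauli) → List (ℕ → Pauli)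
  | 0, _, f => [f]
  | m + 1, start, f => (List.range n).flatMap fun t => [Pauli.X, Pauli.Y, Pauli.Z].flatMap fun p =>
      strings n m (start + t + 1) (update f (start + t) p)

theorem agree_update_iff {r : ℕ} (hr : 10 ≤ r) {ρ₀ ρ : ℕ → ℕ} {v : ℕ} :
    Agree (r + 1) (update ρ₀ r v) ρ ↔ Agree r ρ₀ ρ ∧ ρ r = v := by
  constructor
  · intro h
    refine ⟨fun i hi hi' => ?_, ?_⟩
    · have := h i (by omega) hi'
      rwa [Function.update_of_ne (by omega)] at this
    · simpa using h r (by omega) (by omega)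
  · rintro ⟨h, rfl⟩ i hi hi'
    by_cases hir : i = r
    · subst hir; simp
    · rw [Function.update_of_ne hir]
      exact h i (by omega) hi'

theorem SlotsOK.cons {r : ℕ} (hr : 10 ≤ r) {ρ₀ : ℕ → ℕ} {acc : List (ℕ × Pauli)}
    (h : SlotsOK r ρ₀ acc) {v : ℕ} (hv : nextPos ρ₀ acc ≤ v) {p : Pauli} (hp : p ≠ .I) :
    SlotsOK (r + 1) (update ρ₀ r v) ((r, p) :: acc) := by
  have hne : ∀ s ∈ acc, update ρ₀ r v s.1 = ρ₀ s.1 := fun s hs =>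
    Function.update_of_ne (by have := (h.reg s hs).2; omega) _ _
  constructor
  · intro s hs
    rcases List.mem_cons.mp hs with rfl | hs
    · simp [hr]
    · have := h.reg s hs
      omega
  · intro s hs
    rcases List.mem_cons.mp hs with rfl | hs
    · exact hp
    · exact h.label s hs
  · intro s hs
    simp only [nextPos, Function.update_self]
    rcases List.mem_cons.mp hs with rfl | hs
    · simp
    · rw [hne s hs]
      have := h.lt s hs
      omega
  · rw [List.map_cons, List.nodup_cons]
    have hmap : acc.map (fun s => update ρ₀ r v s.1) = acc.map fun s => ρ₀ s.1 :=
      List.map_congr_left hne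
    rw [hmap]
    refine ⟨?_, h.nodup⟩
    simp only [Function.update_self, List.mem_map, not_exists, not_and]
    intro s hs
    have := h.lt s hs
    omega

theorem SlotsOK.mono {r r' : ℕ} {ρ ρ' : ℕ → ℕ} {acc : List (ℕ × Pauli)} (h : SlotsOK r ρ acc)
    (hr : r ≤ r') (hρ : ∀ i < r, ρ' i = ρ i) : SlotsOK r' ρ' acc := by
  have hne : ∀ s ∈ acc, ρ' s.1 = ρ s.1 := fun s hs => hρ _ (h.reg s hs).2
  refine ⟨fun s hs => ⟨(h.reg s hs).1, (h.reg s hs).2.trans_le hr⟩, h.label, fun s hs => ?_, ?_⟩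
  · have h1 : nextPos ρ' acc = nextPos ρ acc := by
      cases acc with
      | nil => rfl
      | cons a acc => simp [nextPos, hne a List.mem_cons_self]
    rw [hne s hs, h1]
    exact h.lt s hs
  · rw [List.map_congr_left hne]
    exact h.nodup

theorem slotsOK_nil (r : ℕ) (ρ : ℕ → ℕ) : SlotsOK r ρ [] :=
  ⟨by simp, by simp, by simp, by simp⟩

/-- Registers below `rb` belong to the surrounding program; for the inner enumeration they include
the positions of the outer string. The position registers of the complete string lie below `re`. -/
theorem transforms_nest {n : ℕ} (U : Operator n) {body : List (ℕ × Pauli) → Program}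
    {B : (ℕ → Pauli) → List ℝ} {rb : ℕ} (hrb : 10 ≤ rb) {ρ₁ : ℕ → ℕ} (hn : ρ₁ 0 = n)
    (h2 : ρ₁ 2 = 1)
    {re : ℕ} (hbody : ∀ ρ₀ acc, (∀ i < rb, ρ₀ i = ρ₁ i) → SlotsOK re ρ₀ acc →
      Transforms U re ρ₀ (body acc) (steps (B (labels ρ₀ acc))))
    (m r : ℕ) (ρ₀ : ℕ → ℕ) (acc : List (ℕ × Pauli)) (hr : rb ≤ r) (hre : r + m = re) (hρ₀ : ∀ i < rb, ρ₀ i = ρ₁ i)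
    (hacc : SlotsOK r ρ₀ acc) :
    Transforms U r ρ₀ (nest body m r acc)
      (steps ((strings n m (nextPos ρ₀ acc) (labels ρ₀ acc)).flatMap B)) := by
  induction m generalizing r ρ₀ acc with
  | zero =>
    simp only [strings, List.flatMap_cons, List.flatMap_nil, List.append_nil]
    obtain rfl : r = re := hre
    exact hbody ρ₀ acc hρ₀ hacc
  | succ m ih =>
    have hr10 : 10 ≤ r := hrb.trans hr
    set L : ℕ → List (ℕ → Pauli) := fun t => [Pauli.X, Pauli.Y, Pauli.Z].flatMap fun p =>
      strings n m (nextPos ρ₀ acc + t + 1) (update (labels ρ₀ acc) (nextPos ρ₀ acc + t) p) with hL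
    intro G g hG ρ φ hρ
    set inner : Program := .seq (nest body m (r + 1) ((r, .X) :: acc))
      (.seq (nest body m (r + 1) ((r, .Y) :: acc))
        (.seq (nest body m (r + 1) ((r, .Z) :: acc)) (.add r r 2))) with hinner
    have hinit : (nest body (m + 1) r acc).sem U G ρ φ =
        (inner.sem U)^[n] G (update ρ r (nextPos ρ₀ acc)) φ := by
      have hρ0 : ρ 0 = n := (hρ 0 (by omega) (by omega)).trans ((hρ₀ 0 (by omega)).trans hn)
      have hρ2 : ρ 2 = 1 := (hρ 2 (by omega) (by omega)).trans ((hρ₀ 2 (by omega)).trans h2)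
      have hr0 : (0 : ℕ) ≠ r := by omega
      cases acc with
      | nil => simp [nest, initSlot, Program.sem, nextPos, hr0, hρ0, hinner]
      | cons s acc =>
        have hs := hacc.reg s List.mem_cons_self
        have := hρ s.1 hs.2 (by omega)
        simp [nest, initSlot, Program.sem, nextPos, hr0, hρ0, hρ2, hinner, this]
    -- After `j` passes, with `k` remaining, register `r` points `j` places beyond the first
    -- admissible position.
    have hloop : ∀ k j ρ φ, Agree (r + 1) (update ρ₀ r (nextPos ρ₀ acc + j)) ρ →
        (inner.sem U)^[k] G ρ φ =
          normSq φ * steps (((List.range' j k).flatMap L).flatMap B) g (tally ρ) := by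
      intro k
      induction k with
      | zero =>
        intro j ρ φ hρ
        exact hG ρ φ ((agree_update_iff hr10).mp hρ).1
      | succ k ihk =>
        intro j ρ φ hρ
        rw [Function.iterate_succ_apply', List.range'_succ, List.flatMap_cons,
          List.flatMap_append, steps_append]
        set v := nextPos ρ₀ acc + j with hv
        have hlab : ∀ p, labels (update ρ₀ r v) ((r, p) :: acc) = update (labels ρ₀ acc) v p := by
          intro p
          rw [show labels (update ρ₀ r v) ((r, p) :: acc) =
            update (labels (update ρ₀ r v) acc) (update ρ₀ r v r) p from rfl,
            Function.update_self, labels_congr fun s hs =>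
              Function.update_of_ne (by have := (hacc.reg s hs).2; omega) _ _]
        have hnest : ∀ p, p ≠ .I → Transforms U (r + 1) (update ρ₀ r v)
            (nest body m (r + 1) ((r, p) :: acc))
            (steps ((strings n m (v + 1) (update (labels ρ₀ acc) v p)).flatMap B)) := by
          intro p hp
          have := ih (r + 1) (update ρ₀ r v) ((r, p) :: acc) (by omega) (by omega) (fun i hi => by
            rw [Function.update_of_ne (by omega)]; exact hρ₀ i hi)
            (hacc.cons hr10 (by omega) hp)
          rwa [hlab, show nextPos (update ρ₀ r v) ((r, p) :: acc) = v + 1 by simp [nextPos]] at this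
        have hadd : ∀ ρ φ, Agree (r + 1) (update ρ₀ r v) ρ →
            (Program.add r r 2).sem U ((inner.sem U)^[k] G) ρ φ =
              normSq φ * steps (((List.range' (j + 1) k).flatMap L).flatMap B) g (tally ρ) := by
          intro ρ φ hρ
          obtain ⟨hρ, hρr⟩ := (agree_update_iff hr10).mp hρ
          have hρ2 : ρ 2 = 1 := (hρ 2 (by omega) (by omega)).trans ((hρ₀ 2 (by omega)).trans h2)
          simp only [Program.sem, hρr, hρ2]
          rw [ihk (j + 1)]
          · have h5 : ∀ i, i < 10 → update ρ r (v + 1) i = ρ i := fun i hi =>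
              Function.update_of_ne (by omega) _ _
            simp only [tally, h5 5 (by omega), h5 6 (by omega), h5 7 (by omega)]
          · rw [agree_update_iff hr10]
            refine ⟨fun i hi hi' => ?_, by simp [hv, add_assoc]⟩
            rw [Function.update_of_ne (by omega)]
            exact hρ i hi hi'
        have hX := hnest .X (by decide) _ _ (hnest .Y (by decide) _ _
          (hnest .Z (by decide) _ _ hadd)) ρ φ hρ
        have hLj : L j = strings n m (v + 1) (update (labels ρ₀ acc) v .X) ++
            (strings n m (v + 1) (update (labels ρ₀ acc) v .Y) ++
              strings n m (v + 1) (update (labels ρ₀ acc) v .Z)) := by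
          simp [hL, hv]
        rw [hLj, List.flatMap_append, List.flatMap_append, steps_append, steps_append]
        exact hX
    rw [hinit, hloop n 0, ← List.range_eq_range']
    · congr 1
      have h5 : ∀ i, i < 10 → update ρ r (nextPos ρ₀ acc) i = ρ i := fun i hi =>
        Function.update_of_ne (by omega) _ _
      simp only [tally, h5 5 (by omega), h5 6 (by omega), h5 7 (by omega)]
      rfl
    · rw [agree_update_iff hr10]
      refine ⟨fun i hi hi' => ?_, by simp⟩
      rw [Function.update_of_ne (by omega)]
      exact hρ i hi hi'

/-- The Pauli strings other than the identity with at most `K` tensor factors. -/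
def allStrings (n K : ℕ) : List (ℕ → Pauli) := strings n K 0 fun _ => .I

/-- The squared correlators for all pairs of Pauli strings with at most `K` tensor factors. -/
noncomputable def sqCorrs {n : ℕ} (K : ℕ) (U : Operator n) : List ℝ :=
  (allStrings n K).flatMap fun l => (allStrings n K).map fun m =>
    corr U (onQubits n l) (onQubits n m) ^ 2

/-- The effect of one repetition on expectations. -/
noncomputable def repetition (L : List ℝ) (g : ℕ × ℕ × ℕ → ℝ) : ℕ × ℕ × ℕ → ℝ :=
  fun v => steps L g (v.1, v.2.1, v.2.2 + 1)

theorem transforms_allPairs {n : ℕ} (U : UnitaryOp n) (K : ℕ) {ρ₀ : ℕ → ℕ} (hn : ρ₀ 0 = n)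
    (h2 : ρ₀ 2 = 1) :
    Transforms (U : Operator n) 10 ρ₀ (allPairs K) (repetition (sqCorrs K (U : Operator n))) := by
  have hnest : Transforms (U : Operator n) 10 ρ₀
      (nest (fun accP => nest (fun accQ => compareRuns accP accQ) K (10 + K) []) K 10 [])
      (steps (sqCorrs K (U : Operator n))) := by
    refine transforms_nest (U : Operator n) (B := fun l => (allStrings n K).map fun m =>
      corr (U : Operator n) (onQubits n l) (onQubits n m) ^ 2) le_rfl hn h2 (re := 10 + K)
      (fun ρ₁ accP hρ₁ haccP => ?_) K 10 ρ₀ [] le_rfl rfl (fun _ _ => rfl) (slotsOK_nil _ _)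
    -- The inner list is written as a `flatMap` of singletons, the shape produced by
    -- `transforms_nest`.
    rw [← List.flatMap_singleton' (List.map _ _), List.flatMap_map]
    refine transforms_nest (U : Operator n)
      (B := fun m => [corr (U : Operator n) (onQubits n (labels ρ₁ accP)) (onQubits n m) ^ 2])
      (rb := 10 + K) (ρ₁ := ρ₁) (re := 10 + K + K) (by omega)
      ((hρ₁ 0 (by omega)).trans hn) ((hρ₁ 2 (by omega)).trans h2)
      (fun ρ₂ accQ hρ₂ haccQ => ?_) K (10 + K) ρ₁ [] le_rfl rfl (fun _ _ => rfl) (slotsOK_nil _ _)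
    have := transforms_compareRuns U (by omega)
      ((hρ₂ 0 (by omega)).trans ((hρ₁ 0 (by omega)).trans hn))
      ((hρ₂ 2 (by omega)).trans ((hρ₁ 2 (by omega)).trans h2))
      (haccP.mono (by omega) hρ₂) haccQ
    rwa [labels_congr fun s hs => hρ₂ s.1 (haccP.reg s hs).2] at this
  intro G g hG ρ φ hρ
  have hρ2 : ρ 2 = 1 := (hρ 2 (by omega) (by omega)).trans h2
  rw [allPairs]
  simp only [Program.sem, hρ2]
  rw [hnest G g hG _ _ (hρ.update (by omega) _)]
  simp [repetition, tally]

theorem transforms_repeatPow {n : ℕ} (U : Operator n) {ρ₀ : ℕ → ℕ} (hn : ρ₀ 0 = n) {P : Program}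
    {A : (ℕ × ℕ × ℕ → ℝ) → ℕ × ℕ × ℕ → ℝ} (hP : Transforms U 10 ρ₀ P A) (c : ℕ) :
    Transforms U 10 ρ₀ (repeatPow c P) (A^[n ^ c]) := by
  induction c with
  | zero => simpa [repeatPow] using hP
  | succ c ih =>
    intro G g hG ρ φ hρ
    have hρ0 : ρ 0 = n := (hρ 0 (by omega) (by omega)).trans hn
    have hloop : ∀ k ρ φ, Agree 10 ρ₀ ρ → ((repeatPow c P).sem U)^[k] G ρ φ =
        normSq φ * (A^[n ^ c])^[k] g (tally ρ) := by
      intro k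
      induction k with
      | zero => exact hG
      | succ k ihk =>
        rw [Function.iterate_succ', Function.iterate_succ']
        exact ih _ _ ihk
    rw [pow_succ, Function.iterate_mul]
    simp only [repeatPow, Program.sem, hρ0]
    exact hloop n ρ φ hρ

/-- The indicator of acceptance. -/
noncomputable def accepts : ℕ × ℕ × ℕ → ℝ :=
  fun v => if 2 * v.2.1 + v.2.2 ≤ 2 * v.1 then 1 else 0

/-- Truncated subtraction serves as the comparison: it gives zero exactly when the threshold is
reached. -/
theorem sem_decision {n : ℕ} (U : Operator n) (ρ : ℕ → ℕ) (φ : Bits n → ℂ) :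
    decision.sem U (acceptObservable n) ρ φ = normSq φ * accepts (tally ρ) := by
  have h : ρ 6 + ρ 6 + ρ 7 - (ρ 5 + ρ 5) = 0 ↔ 2 * ρ 6 + ρ 7 ≤ 2 * ρ 5 := by omega
  by_cases h' : 2 * ρ 6 + ρ 7 ≤ 2 * ρ 5
  · simp [decision, Program.sem, acceptObservable, accepts, tally, h.mpr h', h']
  · simp [decision, Program.sem, acceptObservable, accepts, tally, h']
    omega

theorem normSq_zeroVec (n : ℕ) : normSq (zeroVec n) = 1 := by
  rw [normSq, Finset.sum_eq_single fun _ => false]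
  · simp [zeroVec]
  · intro x _ hx
    simp [zeroVec, hx]
  · simp

/-- The algorithm. -/
noncomputable def conservationAlgorithm (K c : ℕ) : OracleAlgorithm := ⟨conservationTest K c, 0⟩

theorem acceptProb_conservationAlgorithm {n : ℕ} (K c : ℕ) (U : UnitaryOp n) :
    (conservationAlgorithm K c).acceptProb n U =
      (repetition (sqCorrs K (U : Operator n)))^[n ^ c] accepts (0, 0, 0) := by
  rw [conservationAlgorithm, OracleAlgorithm.acceptProb_eq]
  set ρ₀ : ℕ → ℕ := update (update (fun _ => 0) 0 n) 2 1 with hρ₀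
  have h := transforms_repeatPow (U : Operator n) (ρ₀ := ρ₀) (by simp [hρ₀])
    (transforms_allPairs U K (by simp [hρ₀]) (by simp [hρ₀])) c
    (decision.sem (U : Operator n) (acceptObservable n)) accepts
    (fun ρ φ _ => sem_decision _ ρ φ) ρ₀ (zeroVec n) (fun i _ _ => rfl)
  rw [normSq_zeroVec, one_mul] at h
  exact h

theorem polyTime_conservationAlgorithm (K c : ℕ) : (conservationAlgorithm K c).PolyTime := by
  refine ⟨(conservationTest K c).cost, fun n U s hs => ?_⟩
  have := Program.time_le_cost (U : Operator n) _ (loopsOverInput_conservationTest K c) _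
    (by simp [OracleAlgorithm.init]) s hs
  simpa [OracleAlgorithm.init] using this.2

/-! ### Concentration of the tally -/

/-- A sign of mean m shifts the centre of a square by m and adds the variance 1 - m² ≤ 1. -/
theorem step_le {m : ℝ} (h0 : 0 ≤ m) (h1 : m ≤ 1) {t : ℕ} {C x a b : ℝ} {g : ℕ × ℕ × ℕ → ℝ}
    (hC : 0 ≤ C)
    (hg : ∀ v, v.2.2 = t → g v ≤ C * (((v.1 : ℝ) - v.2.1 - x) ^ 2 + a) + b)
    (v : ℕ × ℕ × ℕ) (hv : v.2.2 = t) :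
    step m g v ≤ C * (((v.1 : ℝ) - v.2.1 - (x - m)) ^ 2 + (a + 1)) + b := by
  have e1 := hg (v.1 + 1, v.2.1, v.2.2) hv
  have e2 := hg (v.1, v.2.1 + 1, v.2.2) hv
  push_cast at e1 e2
  have e3 := mul_le_mul_of_nonneg_left e1 (show 0 ≤ (1 + m) / 2 by linarith)
  have e4 := mul_le_mul_of_nonneg_left e2 (show 0 ≤ (1 - m) / 2 by linarith)
  have e5 : 0 ≤ C * m ^ 2 := by positivity
  unfold step
  nlinarith

theorem steps_le {L : List ℝ} (hL : ∀ m ∈ L, 0 ≤ m ∧ m ≤ 1) {t : ℕ} {C x a b : ℝ}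
    {g : ℕ × ℕ × ℕ → ℝ} (hC : 0 ≤ C)
    (hg : ∀ v, v.2.2 = t → g v ≤ C * (((v.1 : ℝ) - v.2.1 - x) ^ 2 + a) + b)
    (v : ℕ × ℕ × ℕ) (hv : v.2.2 = t) :
    steps L g v ≤ C * (((v.1 : ℝ) - v.2.1 - (x - L.sum)) ^ 2 + (a + L.length)) + b := by
  induction L generalizing v with
  | nil => simpa [steps] using hg v hv
  | cons m L ih =>
    have hm := hL m List.mem_cons_self
    have := step_le hm.1 hm.2 hC (ih fun m hm => hL m (List.mem_cons_of_mem _ hm)) v hv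
    refine this.trans_eq ?_
    rw [List.sum_cons, List.length_cons]
    push_cast
    ring

/-- The repetition count is tracked because the acceptance threshold depends on its final value `t`.
-/
theorem iterate_repetition_le {L : List ℝ} (hL : ∀ m ∈ L, 0 ≤ m ∧ m ≤ 1) {C x b : ℝ}
    {g : ℕ × ℕ × ℕ → ℝ} (hC : 0 ≤ C) (N t : ℕ)
    (hg : ∀ v, v.2.2 = t → g v ≤ C * ((v.1 : ℝ) - v.2.1 - x) ^ 2 + b)
    (v : ℕ × ℕ × ℕ) (hv : v.2.2 + N = t) :
    (repetition L)^[N] g v ≤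
      C * (((v.1 : ℝ) - v.2.1 - (x - N * L.sum)) ^ 2 + N * L.length) + b := by
  induction N generalizing v with
  | zero => simpa using hg v hv
  | succ N ih =>
    rw [Function.iterate_succ_apply']
    have := steps_le hL hC (t := v.2.2 + 1) (fun v' hv' => ih v' (by omega))
      (v.1, v.2.1, v.2.2 + 1) rfl
    refine this.trans_eq ?_
    push_cast
    ring

theorem steps_neg (L : List ℝ) (g : ℕ × ℕ × ℕ → ℝ) : steps L (-g) = -steps L g := by
  induction L with
  | nil => rfl
  | cons m L ih =>
    funext v
    change step m (steps L (-g)) v = -(step m (steps L g) v)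
    rw [ih]
    simp only [step, Pi.neg_apply]
    ring

/-- Lets a lower bound on acceptance follow from the upper bounds, applied to `-accepts`. -/
theorem iterate_repetition_neg (L : List ℝ) (g : ℕ × ℕ × ℕ → ℝ) (N : ℕ) :
    (repetition L)^[N] (-g) = -(repetition L)^[N] g := by
  induction N with
  | zero => rfl
  | succ N ih =>
    rw [Function.iterate_succ_apply', Function.iterate_succ_apply', ih]
    funext v
    simp only [repetition, steps_neg, Pi.neg_apply]

/-- Acceptance forces a tally difference of at least N/2, so its indicator is at most 4/N² times the
squared difference, whose mean is at most (N S)² + N L. -/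
theorem iterate_repetition_accepts_le {L : List ℝ} (hL : ∀ m ∈ L, 0 ≤ m ∧ m ≤ 1) {N : ℕ}
    (hN : 0 < N) :
    (repetition L)^[N] accepts (0, 0, 0) ≤ 4 * L.sum ^ 2 + 4 * L.length / N := by
  have hN' : (0 : ℝ) < N := Nat.cast_pos.mpr hN
  have h := iterate_repetition_le hL (C := 4 / (N : ℝ) ^ 2) (x := 0) (b := 0) (g := accepts)
    (by positivity) N N ?_ (0, 0, 0) (by simp)
  · refine h.trans_eq ?_
    simp only [Nat.cast_zero]
    field_simp
    ring
  · rintro ⟨c, d, t⟩ rfl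
    simp only [accepts, sub_zero, add_zero]
    split_ifs with hacc
    · have h1 : (2 : ℝ) * d + t ≤ 2 * c := by exact_mod_cast hacc
      simp only at hN'
      rw [div_mul_eq_mul_div, le_div_iff₀ (by positivity)]
      nlinarith
    · positivity

/-- Rejection puts the difference below N/2, hence at distance at least N/2 from the mean N S ≥ N:
Chebyshev. -/
theorem le_iterate_repetition_accepts {L : List ℝ} (hL : ∀ m ∈ L, 0 ≤ m ∧ m ≤ 1) {N : ℕ}
    (hN : 0 < N) (hsum : 1 ≤ L.sum) :
    1 - 4 * L.length / N ≤ (repetition L)^[N] accepts (0, 0, 0) := by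
  have hN' : (0 : ℝ) < N := Nat.cast_pos.mpr hN
  have h := iterate_repetition_le hL (C := 4 / (N : ℝ) ^ 2) (x := N * L.sum) (b := -1)
    (g := -accepts) (by positivity) N N ?_ (0, 0, 0) (by simp)
  · rw [iterate_repetition_neg, Pi.neg_apply] at h
    have : 4 / (N : ℝ) ^ 2 * (((0 : ℕ) - (0 : ℕ) - (N * L.sum - N * L.sum)) ^ 2 + N * L.length) =
        4 * L.length / N := by
      simp only [Nat.cast_zero]
      field_simp
      ring
    rw [this] at h
    linarith
  · rintro ⟨c, d, t⟩ rfl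
    simp only [accepts, Pi.neg_apply]
    simp only at hN'
    split_ifs with hacc
    · have : 0 ≤ 4 / (t : ℝ) ^ 2 * ((c : ℝ) - d - t * L.sum) ^ 2 := by positivity
      linarith
    · have h1 : (2 : ℝ) * c ≤ 2 * d + t := by exact_mod_cast (not_le.mp hacc).le
      have h2 : (t : ℝ) ≤ t * L.sum := le_mul_of_one_le_right hN'.le hsum
      have h3 : 1 ≤ 4 / (t : ℝ) ^ 2 * ((c : ℝ) - d - t * L.sum) ^ 2 := by
        rw [div_mul_eq_mul_div, le_div_iff₀ (by positivity)]
        nlinarith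
      linarith

/-! ### The Pauli strings listed by the program -/

theorem length_strings (n m start : ℕ) (f : ℕ → Pauli) :
    (strings n m start f).length = (3 * n) ^ m := by
  induction m generalizing start f with
  | zero => rfl
  | succ m ih =>
    simp only [strings, List.length_flatMap, ih, List.map_const', List.sum_replicate,
      List.length_cons, List.length_nil, List.length_range, smul_eq_mul]
    ring

theorem apply_of_mem_strings {n m start : ℕ} {f l : ℕ → Pauli} (hl : l ∈ strings n m start f)
    {i : ℕ} (hi : i < start) : l i = f i := by
  induction m generalizing start f with
  | zero => rw [List.mem_singleton.mp hl]
  | succ m ih =>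
    simp only [strings, List.mem_flatMap, List.mem_range] at hl
    obtain ⟨t, -, p, -, hl⟩ := hl
    rw [ih hl (by omega), Function.update_of_ne (by omega)]

/-- The first factor sits at some t < n, inside the register, and later factors lie to its right. At
least one factor is needed, hence `K + 1`. -/
theorem exists_ne_I_of_mem_allStrings {n K : ℕ} {l : ℕ → Pauli}
    (hl : l ∈ allStrings n (K + 1)) : ∃ i, onQubits n l i ≠ .I := by
  simp only [allStrings, strings, List.mem_flatMap, List.mem_range] at hl
  obtain ⟨t, ht, p, hp, hl⟩ := hl
  refine ⟨⟨t, ht⟩, ?_⟩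
  rw [onQubits, apply_of_mem_strings hl (by simp)]
  rw [Nat.zero_add, Function.update_self]
  rintro rfl
  simp at hp

theorem Pauli.mem_of_ne_I {p : Pauli} (hp : p ≠ .I) : p ∈ [Pauli.X, Pauli.Y, Pauli.Z] := by
  cases p <;> simp at hp ⊢

/-- Place the factors of `μ` from left to right and push superfluous ones beyond the register, where
they are void. The last hypothesis keeps the very first factor, which cannot leave the register,
from being superfluous. -/
theorem exists_mem_strings {n m start : ℕ} (hn : 0 < n) {f μ : ℕ → Pauli}
    (h1 : ∀ i < n, i < start → f i = μ i) (h2 : ∀ i < n, start ≤ i → f i = .I)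
    (hcard : ((Finset.Ico start n).filter fun i => μ i ≠ .I).card ≤ m)
    (hstart : 0 < start ∨ ∃ i < n, μ i ≠ .I) :
    ∃ l ∈ strings n m start f, ∀ i < n, l i = μ i := by
  induction m generalizing start f with
  | zero =>
    refine ⟨f, List.mem_singleton_self _, fun i hi => ?_⟩
    by_cases his : i < start
    · exact h1 i hi his
    · rw [h2 i hi (not_lt.mp his)]
      by_contra hne
      have : i ∈ (Finset.Ico start n).filter fun i => μ i ≠ .I :=
        Finset.mem_filter.mpr ⟨Finset.mem_Ico.mpr ⟨not_lt.mp his, hi⟩, fun h => hne h.symm⟩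
      rw [Finset.card_eq_zero.mp (Nat.le_zero.mp hcard)] at this
      simp at this
  | succ m ih =>
    by_cases hex : ∃ i, start ≤ i ∧ i < n ∧ μ i ≠ .I
    · classical
      set i₀ := Nat.find hex with hi₀
      obtain ⟨hs, hin, hμ⟩ := Nat.find_spec hex
      rw [← hi₀] at hs hin hμ
      have hmin : ∀ i < i₀, start ≤ i → μ i = .I := by
        intro i hi his
        by_contra hne
        exact Nat.find_min hex hi ⟨his, hi.trans hin, hne⟩
      refine Exists.elim (ih (start := i₀ + 1) (f := update f i₀ (μ i₀)) ?_ ?_ ?_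
        (Or.inl (Nat.succ_pos _))) ?_
      · intro i hi hi'
        by_cases hii : i = i₀
        · subst hii; simp
        · rw [Function.update_of_ne hii]
          by_cases his : i < start
          · exact h1 i hi his
          · rw [h2 i hi (not_lt.mp his), hmin i (by omega) (not_lt.mp his)]
      · intro i hi hi'
        rw [Function.update_of_ne (by omega)]
        exact h2 i hi (by omega)
      · have hlt : ((Finset.Ico (i₀ + 1) n).filter fun i => μ i ≠ .I).card <
            ((Finset.Ico start n).filter fun i => μ i ≠ .I).card := by
          refine Finset.card_lt_card (Finset.ssubset_iff_of_subset ?_ |>.mpr ⟨i₀, ?_, ?_⟩)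
          · exact Finset.filter_subset_filter _ (Finset.Ico_subset_Ico_left (by omega))
          · exact Finset.mem_filter.mpr ⟨Finset.mem_Ico.mpr ⟨hs, hin⟩, hμ⟩
          · simp
        omega
      · rintro l ⟨hl, hlμ⟩
        refine ⟨l, ?_, hlμ⟩
        simp only [strings, List.mem_flatMap, List.mem_range]
        refine ⟨i₀ - start, by omega, μ i₀, ?_, ?_⟩
        · exact Pauli.mem_of_ne_I hμ
        · rwa [Nat.add_sub_cancel' hs]
    · push Not at hex
      have hpos : 0 < start := by
        rcases hstart with h | ⟨i, hi, hne⟩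
        · exact h
        · by_contra h
          exact hne (hex i (by omega) hi)
      -- The last pass, t = n - 1, puts the factor at start + n - 1 ≥ n, since start > 0.
      refine Exists.elim (ih (start := start + (n - 1) + 1)
        (f := update f (start + (n - 1)) .X) ?_ ?_ ?_ (Or.inl (Nat.succ_pos _))) ?_
      · intro i hi _
        rw [Function.update_of_ne (by omega)]
        by_cases his : i < start
        · exact h1 i hi his
        · rw [h2 i hi (not_lt.mp his), hex i (not_lt.mp his) hi]
      · intro i hi hi'
        omega
      · rw [Finset.Ico_eq_empty (by omega)]
        simp
      · rintro l ⟨hl, hlμ⟩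
        refine ⟨l, ?_, hlμ⟩
        simp only [strings, List.mem_flatMap, List.mem_range]
        exact ⟨n - 1, by omega, .X, by simp, hl⟩

theorem exists_mem_allStrings {n k K : ℕ} (hkK : k ≤ K) {l : Fin n → Pauli}
    (hl : l ∈ localPaulis n k) : ∃ f ∈ allStrings n K, onQubits n f = l := by
  obtain ⟨⟨i, hi⟩, hcard⟩ := (Finset.mem_filter.mp hl).2
  set μ : ℕ → Pauli := fun j => if h : j < n then l ⟨j, h⟩ else .I with hμ
  have hμl : ∀ j : Fin n, μ j = l j := fun j => by simp [hμ]
  refine Exists.elim (exists_mem_strings (n := n) (m := K) (start := 0) (f := fun _ => .I)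
    (μ := μ) i.pos (by simp) (by simp) ?_ (Or.inr ⟨i, i.2, by rwa [hμl]⟩))
    fun f hf => ⟨f, hf.1, funext fun j => (hf.2 j j.2).trans (hμl j)⟩
  · refine le_trans ?_ (hcard.trans hkK)
    rw [← Finset.card_map Fin.valEmbedding]
    refine Finset.card_le_card fun j hj => ?_
    obtain ⟨hj1, hj2⟩ := Finset.mem_filter.mp hj
    have hjn := (Finset.mem_Ico.mp hj1).2
    refine Finset.mem_map.mpr ⟨⟨j, hjn⟩, Finset.mem_filter.mpr ⟨Finset.mem_univ _, ?_⟩, rfl⟩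
    rwa [← hμl]

/-- Repeated entries of the list only add nonnegative terms. -/
theorem sum_le_list_sum {α β : Type*} [DecidableEq β] (s : Finset β) (L : List α) (e : α → β)
    (hs : ∀ b ∈ s, ∃ a ∈ L, e a = b) (φ : β → ℝ) (hφ : ∀ b, 0 ≤ φ b) :
    ∑ b ∈ s, φ b ≤ (L.map fun a => φ (e a)).sum := by
  rw [show (L.map fun a => φ (e a)) = (L.map e).map φ by simp, Finset.sum_list_map_count]
  have hsub : s ⊆ (L.map e).toFinset := fun b hb => by simpa using hs b hb
  refine (Finset.sum_le_sum_of_subset_of_nonneg hsub fun b _ _ => hφ b).trans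
    (Finset.sum_le_sum fun b hb => ?_)
  rw [nsmul_eq_mul]
  refine le_mul_of_one_le_left (hφ b) ?_
  exact_mod_cast List.count_pos_iff.mpr (List.mem_toFinset.mp hb)

/-- The pairs of Pauli strings for which runs are compared. -/
def stringPairs (n K : ℕ) : List ((ℕ → Pauli) × (ℕ → Pauli)) :=
  allStrings n K ×ˢ allStrings n K

theorem sqCorrs_eq {n : ℕ} (K : ℕ) (U : Operator n) :
    sqCorrs K U = (stringPairs n K).map fun q => corr U (onQubits n q.1) (onQubits n q.2) ^ 2 := by
  simp [sqCorrs, stringPairs, SProd.sprod, List.product, List.map_flatMap, Function.comp_def]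

theorem length_stringPairs (n K : ℕ) : (stringPairs n K).length = (3 * n) ^ (2 * K) := by
  rw [stringPairs, List.length_product, allStrings, length_strings, two_mul, pow_add]

theorem mem_sqCorrs {n K : ℕ} (U : UnitaryOp n) :
    ∀ m ∈ sqCorrs K (U : Operator n), 0 ≤ m ∧ m ≤ 1 := by
  intro m hm
  rw [sqCorrs_eq, List.mem_map] at hm
  obtain ⟨q, -, rfl⟩ := hm
  exact ⟨sq_nonneg _, corr_sq_le_one _ _ _⟩

theorem one_le_sum_sqCorrs {n k d K : ℕ} (hkK : k ≤ K) {H : Operator n}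
    (hH : IsLocalHamiltonian k d H) (hscal : ∀ c : ℂ, H ≠ c • (1 : Operator n)) (U : UnitaryOp n)
    (hU : Commute (U : Operator n) H) : 1 ≤ (sqCorrs K (U : Operator n)).sum := by
  have hcov := fun l (hl : l ∈ localPaulis n k) => exists_mem_allStrings hkK hl
  have h := sum_map_flatMap (allStrings n K)
    (fun l => (allStrings n K).map fun m =>
      corr (U : Operator n) (onQubits n l) (onQubits n m) ^ 2) id
  simp only [List.map_id_fun, id_eq] at h
  rw [sqCorrs, h]
  refine (one_le_sum_corr_sq hH hscal U hU).trans ?_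
  refine (sum_le_list_sum _ (allStrings n K) (onQubits n) hcov _
    fun l => Finset.sum_nonneg fun m _ => sq_nonneg _).trans ?_
  refine List.sum_le_sum fun l _ => ?_
  exact sum_le_list_sum _ (allStrings n K) (onQubits n) hcov _ fun m => sq_nonneg _

/-! ### Averages over unitaries -/

theorem continuous_steps {X α : Type*} [TopologicalSpace X] (L : List α) {F : α → X → ℝ}
    (hF : ∀ a, Continuous (F a)) {g : X → ℕ × ℕ × ℕ → ℝ} (hg : ∀ v, Continuous fun x => g x v)
    (v : ℕ × ℕ × ℕ) : Continuous fun x => steps (L.map fun a => F a x) (g x) v := by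
  induction L generalizing v with
  | nil => exact hg v
  | cons a L ih =>
    simp only [List.map_cons, steps, List.foldr_cons, step]
    have h := hF a
    exact (((continuous_const.add h).div_const 2).mul (ih _)).add
      (((continuous_const.sub h).div_const 2).mul (ih _))

/-- The acceptance probability is a polynomial in the correlators. On the compact unitary group
continuity yields integrability. -/
theorem continuous_acceptProb {n : ℕ} (K c : ℕ) :
    Continuous fun U : UnitaryOp n => (conservationAlgorithm K c).acceptProb n U := by
  have key : ∀ (N : ℕ) (v : ℕ × ℕ × ℕ), Continuous fun U : UnitaryOp n =>
      (repetition (sqCorrs K (U : Operator n)))^[N] accepts v := by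
    intro N
    induction N with
    | zero => exact fun v => continuous_const
    | succ N ih =>
      intro v
      have hs : ∀ U : UnitaryOp n, (repetition (sqCorrs K (U : Operator n)))^[N + 1] accepts v =
          steps (sqCorrs K (U : Operator n)) ((repetition (sqCorrs K (U : Operator n)))^[N] accepts)
            (v.1, v.2.1, v.2.2 + 1) := by
        intro U
        rw [Function.iterate_succ_apply']
        rfl
      refine (continuous_congr hs).mpr ?_
      simp only [sqCorrs_eq] at ih ⊢
      exact continuous_steps (stringPairs n K)
        (F := fun q (U : UnitaryOp n) =>
          corr (U : Operator n) (onQubits n q.1) (onQubits n q.2) ^ 2)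
        (fun q => (continuous_corr (onQubits n q.1) (onQubits n q.2)).pow 2) ih _
  simp only [acceptProb_conservationAlgorithm]
  exact key _ _

/-- Linearizes S², so that the Haar average needs only second moments of the correlators. -/
theorem list_sum_sq_le {L : List ℝ} (hL : ∀ m ∈ L, 0 ≤ m ∧ m ≤ 1) :
    L.sum ^ 2 ≤ L.length * L.sum := by
  have h0 : 0 ≤ L.sum := List.sum_nonneg fun m hm => (hL m hm).1
  have h1 : L.sum ≤ L.length := by
    have := List.sum_le_card_nsmul L 1 fun m hm => (hL m hm).2
    simpa using this
  rw [sq]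
  exact mul_le_mul_of_nonneg_right h1 h0

theorem integral_list_sum_le {X α : Type*} [MeasurableSpace X] (μ : Measure X) (L : List α)
    {F : α → X → ℝ} (hF : ∀ a, Integrable (F a) μ) {C : ℝ} (hC : ∀ a ∈ L, ∫ x, F a x ∂μ ≤ C) :
    Integrable (fun x => (L.map fun a => F a x).sum) μ ∧
      ∫ x, (L.map fun a => F a x).sum ∂μ ≤ L.length * C := by
  induction L with
  | nil => simp
  | cons a L ih =>
    obtain ⟨h1, h2⟩ := ih fun a ha => hC a (List.mem_cons_of_mem _ ha)
    simp only [List.map_cons, List.sum_cons, List.length_cons]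
    refine ⟨(hF a).add h1, ?_⟩
    rw [integral_add (hF a) h1]
    have := hC a List.mem_cons_self
    push_cast
    linarith

theorem integral_sum_sqCorrs_le (n K : ℕ) :
    Integrable (fun U : UnitaryOp n => (sqCorrs (K + 1) (U : Operator n)).sum) (haarEnsemble n) ∧
      ∫ U, (sqCorrs (K + 1) (U : Operator n)).sum ∂(haarEnsemble n) ≤
        (stringPairs n (K + 1)).length * (2 / 4 ^ n) := by
  simp only [sqCorrs_eq]
  refine integral_list_sum_le (haarEnsemble n) (stringPairs n (K + 1))
    (F := fun q U => corr (U : Operator n) (onQubits n q.1) (onQubits n q.2) ^ 2) (fun q => integrable_of_continuous _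
    ((continuous_corr (onQubits n q.1) (onQubits n q.2)).pow 2)) fun q hq => ?_
  have hq1 : q.1 ∈ allStrings n (K + 1) := (List.mem_product (a := q.1) (b := q.2).mp hq).1
  exact integral_corr_sq_le (exists_ne_I_of_mem_allStrings hq1) _

/-- The constants 24 = 6 · 4 and 48 = 6 · 8 make the errors 4L/N and 8L²/4ⁿ at most 1/6 each. -/
theorem eventually_length_stringPairs_le (K : ℕ) : ∃ n₀ : ℕ, ∀ n, n₀ ≤ n → 0 < n ∧
    24 * (stringPairs n K).length ≤ n ^ (2 * K + 1) ∧
      48 * ((stringPairs n K).length : ℝ) ^ 2 ≤ 4 ^ n := by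
  have h := (tendsto_pow_const_div_const_pow_of_one_lt (4 * K)
    (show (1 : ℝ) < 4 by norm_num)).eventually_lt_const
    (show (0 : ℝ) < (48 * 3 ^ (4 * K))⁻¹ by positivity)
  obtain ⟨n₁, hn₁⟩ := Filter.eventually_atTop.mp h
  refine ⟨max n₁ (24 * 3 ^ (2 * K)), fun n hn => ⟨?_, ?_, ?_⟩⟩
  · exact (show 0 < 24 * 3 ^ (2 * K) by positivity).trans_le ((le_max_right _ _).trans hn)
  · rw [length_stringPairs, mul_pow, ← mul_assoc, pow_succ']
    exact Nat.mul_le_mul_right _ ((le_max_right _ _).trans hn)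
  · have := hn₁ n ((le_max_left _ _).trans hn)
    rw [div_lt_iff₀ (by positivity), inv_mul_eq_div, lt_div_iff₀ (by positivity)] at this
    refine le_trans (le_of_eq ?_) this.le
    rw [length_stringPairs]
    push_cast
    rw [mul_pow, mul_pow, ← pow_mul, ← pow_mul]
    ring

/-- The bound holds for almost every U separately; nothing about the ensemble beyond commutation
enters. -/
theorem two_thirds_le_integral {n k d : ℕ} (hn : 0 < n)
    (hlen : 24 * (stringPairs n (k + 1)).length ≤ n ^ (2 * (k + 1) + 1)) {H : Operator n}
    (hH : IsLocalHamiltonian k d H) (hscal : ∀ c : ℂ, H ≠ c • (1 : Operator n))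
    (μ : Measure (UnitaryOp n)) [IsProbabilityMeasure μ]
    (hμ : ∀ᵐ U ∂μ, Commute (U.1 : Operator n) H) :
    2 / 3 ≤ ∫ U, (conservationAlgorithm (k + 1) (2 * (k + 1) + 1)).acceptProb n U ∂μ := by
  have hint := integrable_of_continuous μ
    (continuous_acceptProb (n := n) (k + 1) (2 * (k + 1) + 1))
  have hT : 0 < n ^ (2 * (k + 1) + 1) := by positivity
  have hle : ∀ᵐ U ∂μ, (2 / 3 : ℝ) ≤
      (conservationAlgorithm (k + 1) (2 * (k + 1) + 1)).acceptProb n U := by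
    filter_upwards [hμ] with U hU
    rw [acceptProb_conservationAlgorithm]
    refine le_trans ?_ (le_iterate_repetition_accepts (mem_sqCorrs U) hT
      (one_le_sum_sqCorrs (Nat.le_succ k) hH hscal U hU))
    rw [sqCorrs_eq, List.length_map]
    have hT' : (0 : ℝ) < (n ^ (2 * (k + 1) + 1) : ℕ) := Nat.cast_pos.mpr hT
    have : 4 * ((stringPairs n (k + 1)).length : ℝ) / (n ^ (2 * (k + 1) + 1) : ℕ) ≤ 1 / 6 := by
      rw [div_le_iff₀ hT']
      have : (24 * (stringPairs n (k + 1)).length : ℝ) ≤ (n ^ (2 * (k + 1) + 1) : ℕ) := by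
        exact_mod_cast hlen
      linarith
    linarith
  have := integral_mono_ae (integrable_const _) hint hle
  simpa using this

theorem integral_haar_le_one_third {n K : ℕ} (hn : 0 < n)
    (hlen : 24 * (stringPairs n (K + 1)).length ≤ n ^ (2 * (K + 1) + 1))
    (hlen' : 48 * ((stringPairs n (K + 1)).length : ℝ) ^ 2 ≤ 4 ^ n) :
    ∫ U, (conservationAlgorithm (K + 1) (2 * (K + 1) + 1)).acceptProb n U ∂(haarEnsemble n) ≤
      1 / 3 := by
  set N : ℝ := ((stringPairs n (K + 1)).length : ℝ) with hN
  have hint := integrable_of_continuous (haarEnsemble n)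
    (continuous_acceptProb (n := n) (K + 1) (2 * (K + 1) + 1))
  have hT : 0 < n ^ (2 * (K + 1) + 1) := by positivity
  obtain ⟨h1, h2⟩ := integral_sum_sqCorrs_le n K
  have hle : ∀ U : UnitaryOp n,
      (conservationAlgorithm (K + 1) (2 * (K + 1) + 1)).acceptProb n U ≤
        4 * N * (sqCorrs (K + 1) (U : Operator n)).sum + 1 / 6 := by
    intro U
    rw [acceptProb_conservationAlgorithm]
    refine (iterate_repetition_accepts_le (mem_sqCorrs U) hT).trans ?_
    have hsq := list_sum_sq_le (mem_sqCorrs (K := K + 1) U)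
    have hl : ((sqCorrs (K + 1) (U : Operator n)).length : ℝ) = N := by
      rw [sqCorrs_eq, List.length_map]
    rw [hl] at hsq ⊢
    have hT' : (0 : ℝ) < (n ^ (2 * (K + 1) + 1) : ℕ) := Nat.cast_pos.mpr hT
    have : 4 * N / (n ^ (2 * (K + 1) + 1) : ℕ) ≤ 1 / 6 := by
      rw [div_le_iff₀ hT']
      have : 24 * N ≤ (n ^ (2 * (K + 1) + 1) : ℕ) := by
        rw [hN]
        exact_mod_cast hlen
      linarith
    linarith
  refine (integral_mono (g := fun U : UnitaryOp n =>
    4 * N * (sqCorrs (K + 1) (U : Operator n)).sum + 1 / 6) hint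
    ((h1.const_mul _).add (integrable_const _)) hle).trans ?_
  rw [integral_add (h1.const_mul _) (integrable_const _), integral_const_mul]
  have h3 : 4 * N * ∫ U, (sqCorrs (K + 1) (U : Operator n)).sum ∂(haarEnsemble n) ≤ 1 / 6 := by
    have hN0 : 0 ≤ 4 * N := by positivity
    refine (mul_le_mul_of_nonneg_left h2 hN0).trans ?_
    rw [← hN, show 4 * N * (N * (2 / 4 ^ n)) = 8 * N ^ 2 / 4 ^ n by ring,
      div_le_iff₀ (by positivity)]
    linarith
  simp only [integral_const, probReal_univ, smul_eq_mul]
  linarith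

end EnergyConservation

theorem mainTheorem6 (k d : ℕ) :
    ∃ A : OracleAlgorithm, A.PolyTime ∧ ∃ n₀ : ℕ, ∀ n : ℕ, n₀ ≤ n →
      ∀ H : Operator n, IsLocalHamiltonian k d H → (∀ c : ℂ, H ≠ c • (1 : Operator n)) →
        ∀ μ : Measure (UnitaryOp n), IsProbabilityMeasure μ →
          (∀ᵐ U ∂μ, Commute (U.1 : Operator n) H) →
            2 / 3 ≤ ∫ U, A.acceptProb n U ∂μ ∧
              ∫ U, A.acceptProb n U ∂(haarEnsemble n) ≤ 1 / 3 := by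
  obtain ⟨n₀, hn₀⟩ := eventually_length_stringPairs_le (k + 1)
  -- Strings of up to k + 1 factors cover the k-local ones and are never the identity. The exponent
  -- 2(k + 1) + 1 exceeds the degree of the number of pairs by one.
  refine ⟨conservationAlgorithm (k + 1) (2 * (k + 1) + 1), polyTime_conservationAlgorithm _ _,
    n₀, fun n hn H hH hscal μ _ hμ => ?_⟩
  obtain ⟨hpos, hlen, hlen'⟩ := hn₀ n hn
  exact ⟨two_thirds_le_integral hpos hlen hH hscal μ hμ,
    integral_haar_le_one_third hpos hlen hlen'⟩
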